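/- **Theorem 1.** Let $m,k,d\ge 1$ be integers with $k\le d$, let $0<x_{\min}\le x_{\max}$, $\sigma\ge 0$ and $0<\delta<1$. For a set $S\subset[d]$ with $|S|=k$ call deterministic inputs $x_1,\dots,x_n\in\mathbb R^d$ *admissible for $S$* if $\mathrm{supp}(x_i)=S$ and $|x_{iu}|\in[x_{\min},x_{\max}]$ for all $i\in[n]$, $u\in S$. One observes $(Y_i,\Phi_i)_{i\le n}$, where $Y_i=\Phi_i x_i+W_i$, the $m\times d$ matrices $\Phi_1,\dots,\Phi_n$ are independent with i.i.d. $\mathcal N(0,1/m)$ entries, and the noise vectors $W_i$ are i.i.d. $\mathcal N(0,\sigma^2 I_m)$, independent of the matrices. An estimator is a measurable map $\hat S$ from the data $(Y_i,\Phi_i)_{i\le n}$ to the $k$-element subsets of $[d]$. Let the sample complexity $n^*=n^*(m,k,d,x_{\min},x_{\max},\sigma^2,\delta)$ be the least $n\ge 0$ for which there is an estimator $\hat S$ such that $\Pr(\hat S\ne S)\le\delta$ for all $S$ with $|S|=k$ and all inputs $x_1,\dots,x_n$ admissible for $S$. Put $$B=\frac{x_{\max}^4}{x_{\min}^4}\max\left\{\left(\frac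 km+\frac{\sigma^2}{x_{\max}^2}\right)\log\frac d\delta,\ \left(\frac km+\frac{\sigma^2}{x_{\max}^2}\right)^2\log\frac d\delta\right\}.$$ There is an absolute constant $C>0$ such that, whenever $m\ge 2\log(d/\delta)$, the following hold. 1. $n^*$ exists (is finite) and $n^*\le\max\{1,\,C B\}$; if $m\le k$, then $n^*\le C B$. 2. For every integer $n\ge C B$, let $\tilde\lambda_u=\frac1n\sum_{i=1}^n\big((\Phi_i^\top Y_i)_u\big)^2$ for $u\in[d]$. Then the estimator that returns the $k$ indices with the largest values $\tilde\lambda_u$ (ties broken in favour of the smaller index) has probability of error at most $\delta$, for every $S$ with $|S|=k$ and all admissible inputs. Moreover, for every such $S$ and all admissible inputs $x_1,\dots,x_n$ there is a deterministic threshold $\tau$ (which may depend on $S$ and the inputs) such that $\Pr(\{u\in[d]:\tilde\lambda_u\ge\tau\}\ne S)\le\delta$. -/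

import Mathlib

open MeasureTheory ProbabilityTheory
open scoped NNReal

namespace SupportRecovery

/-- Law of `(Φ, W)`: the entries `Φ (i, a, j)` of the `n` measurement matrices (sample `i`, row `a`,
column `j`) are i.i.d. `N(0, 1/m)`, the noise entries `W (i, a)` are i.i.d. `N(0, σ²)`, and the
matrices and the noise are independent. -/
noncomputable def ensembleLaw (n m d : ℕ) (σ : ℝ≥0) :
    Measure ((Fin n × Fin m × Fin d → ℝ) × (Fin n × Fin m → ℝ)) :=
  (Measure.pi fun _ => gaussianReal 0 (m : ℝ≥0)⁻¹).prod (Measure.pi fun _ => gaussianReal 0 (σ ^ 2))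

/-- The measurements `Y_i = Φ_i x_i + W_i`, `i = 1, …, n`. -/
def measurements {n m d : ℕ} (x : Fin n → Fin d → ℝ) (Φ : Fin n × Fin m × Fin d → ℝ)
    (W : Fin n × Fin m → ℝ) : Fin n × Fin m → ℝ :=
  fun p => ∑ j, Φ (p.1, p.2, j) * x p.1 j + W p

/-- The inputs `x_1, …, x_n` have common support `S`, with nonzero magnitudes in `[xmin, xmax]`. -/
def AdmissibleInputs {n d : ℕ} (S : Finset (Fin d)) (xmin xmax : ℝ) (x : Fin n → Fin d → ℝ) : Prop :=
  ∀ i, Function.support (x i) = (S : Set (Fin d)) ∧ ∀ u ∈ S, |x i u| ∈ Set.Icc xmin xmax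

/-- A (measurable) estimator: it maps the data `(Y, Φ)` to a subset of `[d]` of cardinality `k`. -/
structure SupportEstimator (n m d k : ℕ) where
  toFun : (Fin n × Fin m → ℝ) → (Fin n × Fin m × Fin d → ℝ) → Finset (Fin d)
  card_eq : ∀ Y Φ, (toFun Y Φ).card = k
  measurableSet_eq : ∀ T : Finset (Fin d),
    MeasurableSet {p : (Fin n × Fin m → ℝ) × (Fin n × Fin m × Fin d → ℝ) | toFun p.1 p.2 = T}

/-- The probability that the random set `g (Y, Φ)` differs from `S`, when the inputs are `x`. -/
noncomputable def errorProb {n m d : ℕ} (σ : ℝ≥0)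
    (g : (Fin n × Fin m → ℝ) → (Fin n × Fin m × Fin d → ℝ) → Finset (Fin d))
    (S : Finset (Fin d)) (x : Fin n → Fin d → ℝ) : ℝ :=
  (ensembleLaw n m d σ).real {ω | g (measurements x ω.1 ω.2) ω.1 ≠ S}

/-- The estimator recovers every support of cardinality `k` from all admissible inputs, with
probability of error at most `δ`. -/
def Recovers {n m d k : ℕ} (e : SupportEstimator n m d k) (xmin xmax : ℝ) (σ : ℝ≥0) (δ : ℝ) : Prop :=
  ∀ S : Finset (Fin d), S.card = k → ∀ x : Fin n → Fin d → ℝ, AdmissibleInputs S xmin xmax x →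
    errorProb σ e.toFun S x ≤ δ

/-- The numbers of samples `n` for which some estimator recovers the support. -/
def feasibleSampleSizes (m k d : ℕ) (xmin xmax : ℝ) (σ : ℝ≥0) (δ : ℝ) : Set ℕ :=
  {n | ∃ e : SupportEstimator n m d k, Recovers e xmin xmax σ δ}

/-- The sample complexity of support recovery. -/
noncomputable def sampleComplexity (m k d : ℕ) (xmin xmax : ℝ) (σ : ℝ≥0) (δ : ℝ) : ℕ :=
  sInf (feasibleSampleSizes m k d xmin xmax σ δ)

/-- The sample second moments `(1/n) ∑ i, ((Φ_iᵀ Y_i)_u)²` for each coordinate `u`. -/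
noncomputable def secondMoment {n m d : ℕ} (Y : Fin n × Fin m → ℝ) (Φ : Fin n × Fin m × Fin d → ℝ)
    (u : Fin d) : ℝ :=
  (1 / (n : ℝ)) * ∑ i, (∑ a, Φ (i, a, u) * Y (i, a)) ^ 2

/-- The coordinates whose sample second moment is at least `τ`. -/
noncomputable def thresholdSet {n m d : ℕ} (τ : ℝ) (Y : Fin n × Fin m → ℝ)
    (Φ : Fin n × Fin m × Fin d → ℝ) : Finset (Fin d) :=
  {u | τ ≤ secondMoment Y Φ u}

/-- The number of coordinates that precede `u` when the values of `l` are sorted in decreasing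
order, ties being broken by the index. -/
noncomputable def rank {d : ℕ} (l : Fin d → ℝ) (u : Fin d) : ℕ :=
  Finset.card {v | l u < l v ∨ (l v = l u ∧ v < u)}

/-- The indices of the `k` largest values of `l`. -/
noncomputable def largest {d : ℕ} (k : ℕ) (l : Fin d → ℝ) : Finset (Fin d) :=
  {u | rank l u < k}

theorem rank_lt_rank {d : ℕ} (l : Fin d → ℝ) {u v : Fin d}
    (h : l u < l v ∨ (l v = l u ∧ v < u)) : rank l v < rank l u := by
  apply Finset.card_lt_card
  rw [Finset.ssubset_iff_of_subset]
  · exact ⟨v, by simpa using h, by simp⟩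
  · intro w
    simp only [Finset.mem_filter, Finset.mem_univ, true_and]
    grind

theorem rank_injective {d : ℕ} (l : Fin d → ℝ) : Function.Injective (rank l) := by
  intro u v huv
  by_contra hne
  rcases lt_trichotomy (l u) (l v) with h | h | h
  · have := rank_lt_rank l (Or.inl h); omega
  · rcases lt_or_gt_of_ne hne with h' | h'
    · have := rank_lt_rank l (Or.inr ⟨h, h'⟩); omega
    · have := rank_lt_rank l (Or.inr ⟨h.symm, h'⟩); omega
  · have := rank_lt_rank l (Or.inl h); omega

theorem rank_lt {d : ℕ} (l : Fin d → ℝ) (u : Fin d) : rank l u < d := by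
  have : rank l u < (Finset.univ : Finset (Fin d)).card := by
    apply Finset.card_lt_card
    rw [Finset.ssubset_iff_of_subset (Finset.subset_univ _)]
    exact ⟨u, Finset.mem_univ _, by simp⟩
  simpa using this

theorem card_largest {d k : ℕ} (hk : k ≤ d) (l : Fin d → ℝ) : (largest k l).card = k := by
  have himg : Finset.univ.image (rank l) = Finset.range d := by
    apply Finset.eq_of_subset_of_card_le
    · intro r hr
      obtain ⟨u, -, rfl⟩ := Finset.mem_image.1 hr
      exact Finset.mem_range.2 (rank_lt l u)
    · rw [Finset.card_image_of_injective _ (rank_injective l)]; simp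
  have h2 : (largest k l).image (rank l) = Finset.range k := by
    ext r
    simp only [largest, Finset.mem_image, Finset.mem_filter, Finset.mem_univ, true_and,
      Finset.mem_range]
    constructor
    · rintro ⟨u, hu, rfl⟩; exact hu
    · intro hr
      have : r ∈ Finset.univ.image (rank l) := by
        rw [himg]; exact Finset.mem_range.2 (lt_of_lt_of_le hr hk)
      obtain ⟨u, -, rfl⟩ := Finset.mem_image.1 this
      exact ⟨u, hr, rfl⟩
  rw [← Finset.card_image_of_injective _ (rank_injective l), h2, Finset.card_range]

theorem measurable_rank {d : ℕ} (u : Fin d) : Measurable fun l : Fin d → ℝ => rank l u := by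
  simp only [rank, Finset.card_filter]
  refine Finset.measurable_sum _ fun v _ => Measurable.ite ?_ measurable_const measurable_const
  refine (measurableSet_lt (measurable_pi_apply u) (measurable_pi_apply v)).union ?_
  exact (measurableSet_eq_fun (measurable_pi_apply v) (measurable_pi_apply u)).inter
    (MeasurableSet.const _)

theorem measurableSet_largest_eq {d : ℕ} (k : ℕ) (T : Finset (Fin d)) :
    MeasurableSet {l : Fin d → ℝ | largest k l = T} := by
  have : {l : Fin d → ℝ | largest k l = T} = ⋂ u, {l | rank l u < k ↔ u ∈ T} := by
    ext l
    simp [largest, Finset.ext_iff]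
  rw [this]
  refine MeasurableSet.iInter fun u => ?_
  exact (measurable_rank u) (t := {r | r < k ↔ u ∈ T}) (MeasurableSet.of_discrete)

/-- The closed-form estimator: the `k` indices with the largest sample second moments. -/
noncomputable def closedFormEstimator (n m : ℕ) {d k : ℕ} (hk : k ≤ d) :
    SupportEstimator n m d k where
  toFun Y Φ := largest k (secondMoment Y Φ)
  card_eq _ _ := card_largest hk _
  measurableSet_eq T := by
    have : Measurable fun p : (Fin n × Fin m → ℝ) × (Fin n × Fin m × Fin d → ℝ) =>
        secondMoment p.1 p.2 := by
      unfold secondMoment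
      fun_prop
    exact this (measurableSet_largest_eq k T)

/-- The quantity
`(xmax⁴/xmin⁴) max {(k/m + σ²/xmax²) log (d/δ), (k/m + σ²/xmax²)² log (d/δ)}`. -/
noncomputable def sampleBound (m k d : ℕ) (xmin xmax : ℝ) (σ : ℝ≥0) (δ : ℝ) : ℝ :=
  xmax ^ 4 / xmin ^ 4 *
    max (((k : ℝ) / m + (σ : ℝ) ^ 2 / xmax ^ 2) * Real.log (d / δ))
      (((k : ℝ) / m + (σ : ℝ) ^ 2 / xmax ^ 2) ^ 2 * Real.log (d / δ))

end SupportRecovery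

/-!
Fix a coordinate `u` and write one measurement as `Y = x_u Φ_u + Z`. The column `Φ_u` and the
vector `Z` are independent Gaussian vectors with entries of variance `1 / m` and
`v = s - x_u² / m`, where `s = ‖x‖² / m + σ²` (`measurePreserving_splitColumn`). Hence, given the
energy `p = ‖Φ_u‖²`, the response `⟨Φ_u, Y⟩ = x_u p + ⟨Φ_u, Z⟩` is Gaussian with mean `x_u p` and
variance `v p`. Its second moment is `s` for `u` off the support and at least `s + x_u²` on the
support. The sum of the `s` over the samples does not depend on `u`, so its average plus `xmin² / 4`
separates the two groups of coordinates, provided that the sums of squared responses concentrate.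
Both tails are bounded by Chernoff's method with `θ = 16 L / (n xmin²)`, `L = log (d / δ)`, so that
a union bound over the `d` coordinates gives the total error `δ`.

* Lower tail, on the support (`lintegral_exp_neg_response_sq_le`). The conditional exponential moment
  given `p` is explicit. It is bounded using the tangent at `p = 1` of the convex function
  `p ↦ p² / (1 + 2 θ v p)`. This leaves a second-order term of the size of the variance,
  `v² + v x_u² + x_u⁴ / m`, rather than of the second moment, which would contain `x_u⁴`.
* Upper tail, off the support (`lintegral_exp_response_sq_le`). The squared response is a Gaussian
  chaos of degree four and has no exponential moments. It is restricted to `p ≤ T` with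
  `T = n xmin² / (64 L q)`, where `q = k xmax² / m + σ²`; then `θ v p ≤ 1 / 4` and the exponential
  moment is again of the right order. The event that `p > T` for some sample has probability at most
  `n exp (-m T / 8)`. As `m ≥ 2 L`, and `L T` is at least of order `√n` by the assumption on `n`,
  this is at most `exp (-2 L)` (`upper_bound_le`).

With `Q = q / xmin²` and `ρ = xmax² / xmin²`, the requirement on `n` amounts to `n ≥ C L ρ Q` and
`n ≥ C L Q²` (`le_of_sampleBound_le`). If `d = 1`, where `L` can be arbitrarily small, the support
is known and there is nothing to recover.
-/

namespace SupportRecovery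

/-! ### Laws of linear functions of independent Gaussian variables -/

lemma measurePreserving_uncurry_pi {α β X : Type*} [Fintype α] [Fintype β] [MeasurableSpace X]
    (μ : Measure X) [SigmaFinite μ] :
    MeasurePreserving (fun (f : α → β → X) (p : α × β) => f p.1 p.2)
      (Measure.pi fun _ => Measure.pi fun _ => μ) (Measure.pi fun _ => μ) := by
  refine ⟨by fun_prop, (Measure.pi_eq fun s hs => ?_).symm⟩
  rw [Measure.map_apply (by fun_prop) (MeasurableSet.univ_pi hs)]
  have : (fun (f : α → β → X) (p : α × β) => f p.1 p.2) ⁻¹' Set.univ.pi s =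
      Set.univ.pi fun a => Set.univ.pi fun b => s (a, b) := by
    ext f; simp [Set.mem_pi]
  rw [this, Measure.pi_pi]
  simp_rw [Measure.pi_pi]
  rw [Fintype.prod_prod_type]

lemma map_finsetSum_eq_gaussianReal {Ω ι : Type*} [MeasurableSpace Ω]
    {P : Measure Ω} [IsProbabilityMeasure P] {X : ι → Ω → ℝ} (hX : ∀ i, Measurable (X i))
    (hind : iIndepFun X P) {v : ι → ℝ≥0} (hlaw : ∀ i, P.map (X i) = gaussianReal 0 (v i))
    (s : Finset ι) : P.map (fun ω => ∑ i ∈ s, X i ω) = gaussianReal 0 (∑ i ∈ s, v i) := by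
  classical
  induction s using Finset.induction_on with
  | empty => simp [gaussianReal_zero_var, Measure.map_const]
  | insert a s ha ih =>
    have h1 : IndepFun (X a) (fun ω => ∑ i ∈ s, X i ω) P := by
      have := (hind.indepFun_finsetSum_of_notMem hX ha).symm
      convert this using 1
      ext ω; simp
    have h2 := gaussianReal_add_gaussianReal_of_indepFun h1 (hlaw a) ih
    rw [add_zero, ← Finset.sum_insert ha] at h2
    rw [← h2]
    congr 1
    ext ω
    simp [Finset.sum_insert ha]

/-- The variance `c²v` of a Gaussian variable of variance `v` multiplied by `c`. -/
noncomputable def scaledVar (c : ℝ) (v : ℝ≥0) : ℝ≥0 := ⟨c ^ 2, sq_nonneg c⟩ * v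

lemma coe_scaledVar (c : ℝ) (v : ℝ≥0) : (scaledVar c v : ℝ) = c ^ 2 * v := rfl

lemma iIndepFun_const_mul_pi {ι : Type*} [Fintype ι] (v : ℝ≥0) (c : ι → ℝ) :
    iIndepFun (fun i (g : ι → ℝ) => c i * g i) (Measure.pi fun _ : ι => gaussianReal 0 v) :=
  iIndepFun_pi (μ := fun _ : ι => gaussianReal 0 v) (X := fun i y => c i * y)
    fun i => by fun_prop

lemma map_const_mul_pi {ι : Type*} [Fintype ι] (v : ℝ≥0) (c : ι → ℝ) (i : ι) :
    (Measure.pi fun _ : ι => gaussianReal 0 v).map (fun g => c i * g i) =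
      gaussianReal 0 (scaledVar (c i) v) := by
  have h := (measurePreserving_eval (fun _ : ι => gaussianReal 0 v) i).map_eq
  have h2 := gaussianReal_map_const_mul (μ := 0) (v := v) (c i)
  rw [← h, Measure.map_map (by fun_prop) (by fun_prop)] at h2
  rw [mul_zero] at h2
  exact h2

lemma map_linear_pi_gaussianReal {ι : Type*} [Fintype ι] (v : ℝ≥0) (c : ι → ℝ) (s : Finset ι) :
    (Measure.pi fun _ : ι => gaussianReal 0 v).map (fun g => ∑ i ∈ s, c i * g i) =
      gaussianReal 0 (∑ i ∈ s, scaledVar (c i) v) :=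
  map_finsetSum_eq_gaussianReal (fun i => by fun_prop) (iIndepFun_const_mul_pi v c)
    (map_const_mul_pi v c) s

/-- The variance of the entries of `Y - x_u Φ_u`, the measurement without the contribution of
coordinate `u`, for the input `x`. -/
noncomputable def crossVar (m : ℕ) {d : ℕ} (σ : ℝ≥0) (x : Fin d → ℝ) (u : Fin d) : ℝ≥0 :=
  ∑ j ∈ Finset.univ.erase u, scaledVar (x j) (m : ℝ≥0)⁻¹ + σ ^ 2

lemma coe_crossVar (m : ℕ) {d : ℕ} (σ : ℝ≥0) (x : Fin d → ℝ) (u : Fin d) :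
    (crossVar m σ x u : ℝ) = (∑ j, x j ^ 2) / m + (σ : ℝ) ^ 2 - x u ^ 2 / m := by
  simp only [crossVar, NNReal.coe_add, NNReal.coe_sum, coe_scaledVar, NNReal.coe_pow,
    NNReal.coe_inv, NNReal.coe_natCast]
  rw [← Finset.sum_mul, ← Finset.add_sum_erase _ _ (Finset.mem_univ u)]
  ring

/-- The law of one row of a measurement matrix together with the noise in that row. -/
noncomputable def rowLaw (m d : ℕ) (σ : ℝ≥0) : Measure ((Fin d → ℝ) × ℝ) :=
  (Measure.pi fun _ => gaussianReal 0 (m : ℝ≥0)⁻¹).prod (gaussianReal 0 (σ ^ 2))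

instance (m d : ℕ) (σ : ℝ≥0) : IsProbabilityMeasure (rowLaw m d σ) := by
  unfold rowLaw; infer_instance

lemma measurePreserving_row {m d : ℕ} (σ : ℝ≥0) (x : Fin d → ℝ) (u : Fin d) :
    MeasurePreserving
      (fun r : (Fin d → ℝ) × ℝ => (r.1 u, ∑ j ∈ Finset.univ.erase u, x j * r.1 j + r.2))
      (rowLaw m d σ)
      ((gaussianReal 0 (m : ℝ≥0)⁻¹).prod (gaussianReal 0 (crossVar m σ x u))) := by
  set P := Measure.pi fun _ : Fin d => gaussianReal 0 (m : ℝ≥0)⁻¹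
  have h0 := map_linear_pi_gaussianReal (m : ℝ≥0)⁻¹ x (Finset.univ.erase u)
  have hu := (measurePreserving_eval (fun _ : Fin d => gaussianReal 0 (m : ℝ≥0)⁻¹) u).map_eq
  -- giving coordinate `u` weight `1` keeps the family of summands independent
  have hind : IndepFun (fun g : Fin d → ℝ => g u)
      (fun g => ∑ j ∈ Finset.univ.erase u, x j * g j) P := by
    have := ((iIndepFun_const_mul_pi (m : ℝ≥0)⁻¹ (Function.update x u 1)).indepFun_finsetSum_of_notMem
      (fun i => by fun_prop) (Finset.notMem_erase u Finset.univ)).symm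
    convert this using 1
    · ext g; simp
    · ext g
      rw [Finset.sum_apply]
      refine Finset.sum_congr rfl fun j hj => ?_
      rw [Function.update_of_ne (Finset.ne_of_mem_erase hj)]
  have h1 : MeasurePreserving
      (fun g : Fin d → ℝ => (g u, ∑ j ∈ Finset.univ.erase u, x j * g j)) P
      ((gaussianReal 0 (m : ℝ≥0)⁻¹).prod
        (gaussianReal 0 (∑ j ∈ Finset.univ.erase u, scaledVar (x j) (m : ℝ≥0)⁻¹))) := by
    refine ⟨by fun_prop, ?_⟩
    rw [(indepFun_iff_map_prod_eq_prod_map_map (Measurable.aemeasurable (by fun_prop))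
      (Measurable.aemeasurable (by fun_prop))).1 hind, h0, ← hu]
  have h2 := h1.prod (MeasurePreserving.id (gaussianReal 0 (σ ^ 2)))
  have h3 := (measurePreserving_prodAssoc (gaussianReal 0 (m : ℝ≥0)⁻¹)
    (gaussianReal 0 (∑ j ∈ Finset.univ.erase u, scaledVar (x j) (m : ℝ≥0)⁻¹))
    (gaussianReal 0 (σ ^ 2))).comp h2
  have h4 : MeasurePreserving (fun p : ℝ × ℝ => p.1 + p.2)
      ((gaussianReal 0 (∑ j ∈ Finset.univ.erase u, scaledVar (x j) (m : ℝ≥0)⁻¹)).prod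
        (gaussianReal 0 (σ ^ 2))) (gaussianReal 0 (crossVar m σ x u)) := by
    refine ⟨by fun_prop, ?_⟩
    have := gaussianReal_conv_gaussianReal (m₁ := 0) (m₂ := 0)
      (v₁ := ∑ j ∈ Finset.univ.erase u, scaledVar (x j) (m : ℝ≥0)⁻¹) (v₂ := σ ^ 2)
    rw [add_zero] at this
    exact this
  exact ((MeasurePreserving.id (gaussianReal 0 (m : ℝ≥0)⁻¹)).prod h4).comp h3

/-- The law of one measurement matrix together with its noise vector, stored row by row. -/
noncomputable def sampleLaw (m d : ℕ) (σ : ℝ≥0) : Measure (Fin m → (Fin d → ℝ) × ℝ) :=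
  Measure.pi fun _ => rowLaw m d σ

instance (m d : ℕ) (σ : ℝ≥0) : IsProbabilityMeasure (sampleLaw m d σ) := by
  unfold sampleLaw; infer_instance

/-- The law of `(Φ_u, Y - x_u Φ_u)`: independent Gaussian vectors with variances `1/m` and `v`. -/
noncomputable def columnLaw (m : ℕ) (v : ℝ≥0) : Measure ((Fin m → ℝ) × (Fin m → ℝ)) :=
  (Measure.pi fun _ => gaussianReal 0 (m : ℝ≥0)⁻¹).prod (Measure.pi fun _ => gaussianReal 0 v)

/-- Column `u` of the matrix, and the measurement without the contribution of that column. -/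
def splitColumn {m d : ℕ} (x : Fin d → ℝ) (u : Fin d) (r : Fin m → (Fin d → ℝ) × ℝ) :
    (Fin m → ℝ) × (Fin m → ℝ) :=
  (fun a => (r a).1 u, fun a => ∑ j ∈ Finset.univ.erase u, x j * (r a).1 j + (r a).2)

lemma measurePreserving_splitColumn {m d : ℕ} (σ : ℝ≥0) (x : Fin d → ℝ) (u : Fin d) :
    MeasurePreserving (splitColumn x u) (sampleLaw m d σ) (columnLaw m (crossVar m σ x u)) :=
  (measurePreserving_arrowProdEquivProdArrow ℝ ℝ (Fin m) (fun _ => gaussianReal 0 (m : ℝ≥0)⁻¹)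
    (fun _ => gaussianReal 0 (crossVar m σ x u))).comp
    (measurePreserving_pi (fun _ => rowLaw m d σ) _ fun _ => measurePreserving_row σ x u)

/-- Reassembles `(Φ, W)` from the samples. -/
def assemble {n m d : ℕ} (r : Fin n → Fin m → (Fin d → ℝ) × ℝ) :
    (Fin n × Fin m × Fin d → ℝ) × (Fin n × Fin m → ℝ) :=
  (fun p => (r p.1 p.2.1).1 p.2.2, fun p => (r p.1 p.2).2)

/-- The samples are independent and identically distributed under `ensembleLaw`. -/
lemma measurePreserving_assemble (n m d : ℕ) (σ : ℝ≥0) :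
    MeasurePreserving assemble (Measure.pi fun _ : Fin n => sampleLaw m d σ)
      (ensembleLaw n m d σ) := by
  have h1 := measurePreserving_pi (fun _ : Fin n => sampleLaw m d σ) _ fun _ =>
    measurePreserving_arrowProdEquivProdArrow (Fin d → ℝ) ℝ (Fin m)
      (fun _ => Measure.pi fun _ => gaussianReal 0 (m : ℝ≥0)⁻¹) (fun _ => gaussianReal 0 (σ ^ 2))
  have h2 := measurePreserving_arrowProdEquivProdArrow (Fin m → Fin d → ℝ) (Fin m → ℝ) (Fin n)
    (fun _ => Measure.pi fun _ => Measure.pi fun _ => gaussianReal 0 (m : ℝ≥0)⁻¹)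
    (fun _ => Measure.pi fun _ => gaussianReal 0 (σ ^ 2))
  have h3 := measurePreserving_uncurry_pi (α := Fin n) (β := Fin m) (gaussianReal 0 (σ ^ 2))
  have h4 := measurePreserving_pi (fun _ : Fin n => _) _ fun _ =>
    measurePreserving_uncurry_pi (α := Fin m) (β := Fin d) (gaussianReal 0 (m : ℝ≥0)⁻¹)
  have h5 := measurePreserving_uncurry_pi (α := Fin n) (β := Fin m × Fin d)
    (gaussianReal 0 (m : ℝ≥0)⁻¹)
  exact ((h5.comp h4).prod h3).comp (h2.comp h1)

/-! ### Exponential moments of one sample -/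

/-- Completing the square in the Gaussian density. No sign is imposed on `θ`, only that the
integral converges. -/
lemma lintegral_exp_neg_mul_sq_gaussianReal (v : ℝ≥0) (θ b : ℝ) (h : 0 < 1 + 2 * θ * v) :
    ∫⁻ y, ENNReal.ofReal (Real.exp (-θ * (b + y) ^ 2)) ∂gaussianReal 0 v =
      ENNReal.ofReal ((√(1 + 2 * θ * v))⁻¹ * Real.exp (-θ * b ^ 2 / (1 + 2 * θ * v))) := by
  rcases eq_or_ne v 0 with rfl | hv
  · simp [gaussianReal_zero_var]
  have hv0 : (0 : ℝ) < v := by positivity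
  set D := 1 + 2 * θ * (v : ℝ) with hD
  set w : ℝ≥0 := v / ⟨D, h.le⟩ with hw
  have hwD : (w : ℝ) = v / D := rfl
  have hw0 : w ≠ 0 := by
    have : (0 : ℝ) < w := by rw [hwD]; positivity
    exact_mod_cast this.ne'
  have key : ∀ y, gaussianPDFReal 0 v y * Real.exp (-θ * (b + y) ^ 2) =
      (√D)⁻¹ * Real.exp (-θ * b ^ 2 / D) * gaussianPDFReal (-(2 * θ * b * v) / D) w y := by
    intro y
    simp only [gaussianPDFReal, hwD]
    have h1 : √(2 * Real.pi * (v / D)) = √(2 * Real.pi * v) / √D := by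
      rw [← mul_div_assoc, Real.sqrt_div (by positivity)]
    have h2 : -(y - 0) ^ 2 / (2 * (v : ℝ)) + -θ * (b + y) ^ 2 =
        -θ * b ^ 2 / D + -(y - -(2 * θ * b * v) / D) ^ 2 / (2 * (v / D)) := by
      field_simp
      rw [hD]; ring
    have h3 : 0 < √D := Real.sqrt_pos.2 h
    rw [mul_assoc, ← Real.exp_add, h2, Real.exp_add, h1, inv_div]
    field_simp
  rw [gaussianReal_of_var_ne_zero _ hv, lintegral_withDensity_eq_lintegral_mul _
    (measurable_gaussianPDF 0 v) (by fun_prop)]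
  have h4 : ∀ y, (gaussianPDF 0 v * fun y => ENNReal.ofReal (Real.exp (-θ * (b + y) ^ 2))) y =
      ENNReal.ofReal ((√D)⁻¹ * Real.exp (-θ * b ^ 2 / D)) *
        ENNReal.ofReal (gaussianPDFReal (-(2 * θ * b * v) / D) w y) := by
    intro y
    rw [← ENNReal.ofReal_mul (by positivity), ← key, Pi.mul_apply, gaussianPDF,
      ← ENNReal.ofReal_mul (gaussianPDFReal_nonneg _ _ _)]
  simp_rw [h4]
  rw [lintegral_const_mul _ (by fun_prop), lintegral_gaussianPDFReal_eq_one _ hw0, mul_one]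

/-- The squared Euclidean norm. -/
def energy {m : ℕ} (g : Fin m → ℝ) : ℝ := ∑ a, g a ^ 2

lemma energy_nonneg {m : ℕ} (g : Fin m → ℝ) : 0 ≤ energy g :=
  Finset.sum_nonneg fun _ _ => sq_nonneg _

@[fun_prop]
lemma measurable_energy {m : ℕ} : Measurable (energy (m := m)) := by
  unfold energy; fun_prop

/-- The law of a column of a measurement matrix. -/
noncomputable def entryLaw (m : ℕ) : Measure (Fin m → ℝ) :=
  Measure.pi fun _ => gaussianReal 0 (m : ℝ≥0)⁻¹

instance (m : ℕ) : IsProbabilityMeasure (entryLaw m) := by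
  unfold entryLaw; infer_instance

lemma lintegral_exp_mul_energy {m : ℕ} (t : ℝ) (ht : 0 < 1 - 2 * t / m) :
    ∫⁻ g, ENNReal.ofReal (Real.exp (t * energy g)) ∂entryLaw m =
      ENNReal.ofReal (((√(1 - 2 * t / m))⁻¹) ^ m) := by
  have hone := lintegral_exp_neg_mul_sq_gaussianReal (m : ℝ≥0)⁻¹ (-t) 0 (by
    simp only [NNReal.coe_inv, NNReal.coe_natCast]; convert ht using 1; ring)
  have h1 : ∀ g : Fin m → ℝ, ENNReal.ofReal (Real.exp (t * energy g)) =
      ∏ a, ENNReal.ofReal (Real.exp (-(-t) * (0 + g a) ^ 2)) := by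
    intro g
    rw [← ENNReal.ofReal_prod_of_nonneg fun _ _ => (Real.exp_pos _).le, ← Real.exp_sum, energy,
      Finset.mul_sum]
    simp
  simp_rw [h1]
  have hind : iIndepFun (fun (a : Fin m) (g : Fin m → ℝ) =>
      ENNReal.ofReal (Real.exp (-(-t) * (0 + g a) ^ 2))) (entryLaw m) :=
    iIndepFun_pi (μ := fun _ : Fin m => gaussianReal 0 (m : ℝ≥0)⁻¹)
      (X := fun _ y => ENNReal.ofReal (Real.exp (-(-t) * (0 + y) ^ 2))) fun _ => by fun_prop
  rw [lintegral_prod_eq_prod_lintegral_of_indepFun _ _ hind fun _ => by fun_prop]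
  have h2 : ∀ a : Fin m,
      ∫⁻ g, ENNReal.ofReal (Real.exp (-(-t) * (0 + g a) ^ 2)) ∂entryLaw m =
        ENNReal.ofReal ((√(1 - 2 * t / m))⁻¹) := by
    intro a
    have := (measurePreserving_eval (fun _ : Fin m => gaussianReal 0 (m : ℝ≥0)⁻¹) a).lintegral_comp
      (f := fun y => ENNReal.ofReal (Real.exp (-(-t) * (0 + y) ^ 2))) (by fun_prop)
    refine this.trans (hone.trans ?_)
    congr 1
    simp only [NNReal.coe_inv, NNReal.coe_natCast]
    rw [show 1 + 2 * -t * (m : ℝ)⁻¹ = 1 - 2 * t / m by ring]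
    simp
  simp_rw [h2]
  rw [Finset.prod_const, Finset.card_univ, Fintype.card_fin, ENNReal.ofReal_pow (by positivity)]

/-- `log (1 + y) ≥ y - y² / 2`, which controls the lower tail of the energy. -/
lemma inv_sqrt_pow_le_exp {m : ℕ} (hm : 0 < m) {t : ℝ} (ht : 0 ≤ t) :
    ((√(1 + 2 * t / m))⁻¹) ^ m ≤ Real.exp (-t + t ^ 2 / m) := by
  have hm' : (0 : ℝ) < m := by exact_mod_cast hm
  set y := 2 * t / m with hy
  have hy0 : 0 ≤ y := by positivity
  have h1 : y - y ^ 2 / 2 ≤ Real.log (1 + y) := by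
    refine le_trans ?_ (Real.le_log_one_add_of_nonneg hy0)
    rw [le_div_iff₀ (by positivity)]
    nlinarith [pow_nonneg hy0 3]
  have h2 : (√(1 + y))⁻¹ = Real.exp (-(Real.log (1 + y) / 2)) := by
    rw [Real.exp_neg, Real.sqrt_eq_rpow, Real.rpow_def_of_pos (by positivity)]
    ring_nf
  rw [h2, ← Real.exp_nat_mul]
  apply Real.exp_le_exp.2
  have h3 : -t + t ^ 2 / m = -(m * ((y - y ^ 2 / 2) / 2)) := by
    rw [hy]; field_simp; ring
  rw [h3]
  nlinarith

lemma lintegral_exp_neg_mul_energy_le {m : ℕ} (hm : 0 < m) {t : ℝ} (ht : 0 ≤ t) :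
    ∫⁻ g, ENNReal.ofReal (Real.exp (-t * (energy g - 1))) ∂entryLaw m ≤
      ENNReal.ofReal (Real.exp (t ^ 2 / m)) := by
  have hm' : (0 : ℝ) < m := by exact_mod_cast hm
  have h := lintegral_exp_mul_energy (-t) (by
    have : 0 ≤ 2 * t / m := by positivity
    rw [show 2 * -t / (m : ℝ) = -(2 * t / m) by ring]; linarith)
  have h1 : ∀ g : Fin m → ℝ, ENNReal.ofReal (Real.exp (-t * (energy g - 1))) =
      ENNReal.ofReal (Real.exp t) * ENNReal.ofReal (Real.exp (-t * energy g)) := by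
    intro g
    rw [← ENNReal.ofReal_mul (Real.exp_pos _).le, ← Real.exp_add]; ring_nf
  simp_rw [h1]
  rw [lintegral_const_mul _ (by fun_prop), h, ← ENNReal.ofReal_mul (Real.exp_pos _).le]
  apply ENNReal.ofReal_le_ofReal
  rw [show 1 - 2 * -t / (m : ℝ) = 1 + 2 * t / m by ring]
  calc _ ≤ Real.exp t * Real.exp (-t + t ^ 2 / m) :=
        mul_le_mul_of_nonneg_left (inv_sqrt_pow_le_exp hm ht) (Real.exp_pos _).le
    _ = _ := by rw [← Real.exp_add]; ring_nf

/-- Markov's inequality for `exp (m p / 4)`, where `p` is the energy. -/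
lemma measure_energy_gt_le {m : ℕ} (hm : 0 < m) {T : ℝ} (hT : 3 ≤ T) :
    entryLaw m {g | T < energy g} ≤ ENNReal.ofReal (Real.exp (-(m * T / 8))) := by
  have hm' : (0 : ℝ) < m := by exact_mod_cast hm
  have hs : 1 - 2 * ((m : ℝ) / 4) / m = 1 / 2 := by field_simp; norm_num
  have h := lintegral_exp_mul_energy ((m : ℝ) / 4) (by rw [hs]; norm_num)
  rw [hs] at h
  have h1 := meas_ge_le_lintegral_div (μ := entryLaw m)
    (f := fun g => ENNReal.ofReal (Real.exp ((m : ℝ) / 4 * energy g))) (by fun_prop)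
    (ε := ENNReal.ofReal (Real.exp (m / 4 * T))) (by simp [Real.exp_pos]) ENNReal.ofReal_ne_top
  refine (measure_mono ?_).trans (h1.trans ?_)
  · intro g hg
    apply ENNReal.ofReal_le_ofReal
    apply Real.exp_le_exp.2
    have : T < energy g := hg
    gcongr
  · rw [h, ← ENNReal.ofReal_div_of_pos (Real.exp_pos _)]
    apply ENNReal.ofReal_le_ofReal
    rw [div_le_iff₀ (Real.exp_pos _), ← Real.exp_add]
    have h2 : (√(1 / 2 : ℝ))⁻¹ ≤ Real.exp (3 / 8) := by
      rw [inv_le_comm₀ (by positivity) (Real.exp_pos _), ← Real.exp_neg]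
      apply Real.le_sqrt_of_sq_le
      rw [← Real.exp_nat_mul]
      have h5 := Real.add_one_le_exp (3 / 8 : ℝ)
      have h6 := Real.quadratic_le_exp_of_nonneg (x := 3 / 4) (by norm_num)
      rw [show ((2 : ℕ) : ℝ) * -(3 / 8) = -(3 / 4) by norm_num, Real.exp_neg,
        inv_le_comm₀ (Real.exp_pos _) (by norm_num)]
      norm_num at h6 ⊢
      linarith
    calc ((√(1 / 2 : ℝ))⁻¹) ^ m ≤ Real.exp (3 / 8) ^ m := by gcongr
      _ = Real.exp (m * (3 / 8)) := (Real.exp_nat_mul _ _).symm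
      _ ≤ _ := by apply Real.exp_le_exp.2; nlinarith

lemma memLp_entryLaw {m : ℕ} (a : Fin m) : MemLp (fun g : Fin m → ℝ => g a) 2 (entryLaw m) :=
  (memLp_id_gaussianReal' (μ := 0) (v := (m : ℝ≥0)⁻¹) 2 (by simp)).comp_measurePreserving
    (measurePreserving_eval (fun _ : Fin m => gaussianReal 0 (m : ℝ≥0)⁻¹) a)

lemma integrable_energy {m : ℕ} : Integrable (energy (m := m)) (entryLaw m) :=
  integrable_finsetSum _ fun a _ => (memLp_entryLaw a).integrable_sq

lemma integral_energy {m : ℕ} (hm : 0 < m) : ∫ g, energy g ∂entryLaw m = 1 := by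
  have hm' : (m : ℝ) ≠ 0 := by exact_mod_cast hm.ne'
  unfold energy
  rw [integral_finsetSum _ fun a _ => (memLp_entryLaw a).integrable_sq]
  have h2 : ∀ a : Fin m, ∫ g, g a ^ 2 ∂entryLaw m = (m : ℝ)⁻¹ := by
    intro a
    have hmp := measurePreserving_eval (fun _ : Fin m => gaussianReal 0 (m : ℝ≥0)⁻¹) a
    have h3 := integral_map (μ := entryLaw m) (φ := fun g : Fin m → ℝ => g a)
      (f := fun y : ℝ => y ^ 2) (Measurable.aemeasurable (by fun_prop)) (by fun_prop)
    have h5 : (entryLaw m).map (fun g : Fin m → ℝ => g a) = gaussianReal 0 (m : ℝ≥0)⁻¹ :=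
      hmp.map_eq
    rw [h5] at h3
    have h4 := variance_fun_id_gaussianReal (μ := 0) (v := (m : ℝ≥0)⁻¹)
    rw [variance_of_integral_eq_zero (by fun_prop) integral_id_gaussianReal] at h4
    rw [← h3, h4]
    simp
  simp [h2, hm']

/-- Used with `p² ≤ 32 exp (p / 4)`, this bounds the second moment of the energy `p`
without Gaussian fourth moments. -/
lemma lintegral_exp_energy_div_four_le {m : ℕ} (hm : 0 < m) :
    ∫⁻ g, ENNReal.ofReal (Real.exp (1 / 4 * energy g)) ∂entryLaw m ≤ ENNReal.ofReal 2 := by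
  have hm' : (1 : ℝ) ≤ m := by exact_mod_cast hm
  have hs : 1 - 2 * (1 / 4 : ℝ) / m = 1 + -(1 / (2 * m)) := by field_simp; ring
  have hb : 1 / (2 * (m : ℝ)) ≤ 1 / 2 := by
    apply one_div_le_one_div_of_le <;> linarith
  rw [lintegral_exp_mul_energy (1 / 4) (by rw [hs]; linarith), hs]
  apply ENNReal.ofReal_le_ofReal
  have h1 := one_add_mul_le_pow (a := -(1 / (2 * (m : ℝ)))) (by linarith) m
  have h2 : 1 + (m : ℝ) * -(1 / (2 * m)) = 1 / 2 := by field_simp; ring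
  rw [h2] at h1
  set y := 1 + -(1 / (2 * (m : ℝ))) with hy
  have hy0 : 0 ≤ y := by rw [hy]; linarith
  have h3 : 1 / 2 ≤ √y ^ m := by
    have h4 : (√y ^ m) ^ 2 = y ^ m := by
      rw [← pow_mul, mul_comm, pow_mul, Real.sq_sqrt hy0]
    have h5 : (0 : ℝ) ≤ √y ^ m := by positivity
    nlinarith
  rw [inv_pow]
  exact inv_le_of_inv_le₀ (by norm_num) (by linarith)

lemma energy_sq_le {m : ℕ} (g : Fin m → ℝ) : energy g ^ 2 ≤ 32 * Real.exp (1 / 4 * energy g) := by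
  have h := Real.quadratic_le_exp_of_nonneg (x := 1 / 4 * energy g)
    (by have := energy_nonneg g; positivity)
  nlinarith [energy_nonneg g]

lemma integrable_exp_energy {m : ℕ} (hm : 0 < m) :
    Integrable (fun g => Real.exp (1 / 4 * energy g)) (entryLaw m) := by
  refine ⟨by fun_prop, ?_⟩
  rw [hasFiniteIntegral_iff_ofReal (ae_of_all _ fun _ => (Real.exp_pos _).le)]
  exact (lintegral_exp_energy_div_four_le hm).trans_lt ENNReal.ofReal_lt_top

lemma integrable_energy_sq {m : ℕ} (hm : 0 < m) :
    Integrable (fun g => energy g ^ 2) (entryLaw m) := by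
  refine ((integrable_exp_energy hm).const_mul 32).mono' (by fun_prop) (ae_of_all _ fun g => ?_)
  rw [Real.norm_of_nonneg (sq_nonneg _)]
  exact energy_sq_le g

lemma integral_energy_sq_le {m : ℕ} (hm : 0 < m) : ∫ g, energy g ^ 2 ∂entryLaw m ≤ 64 := by
  calc ∫ g, energy g ^ 2 ∂entryLaw m
      ≤ ∫ g, 32 * Real.exp (1 / 4 * energy g) ∂entryLaw m :=
        integral_mono (integrable_energy_sq hm) ((integrable_exp_energy hm).const_mul 32)
          energy_sq_le
    _ = 32 * ∫ g, Real.exp (1 / 4 * energy g) ∂entryLaw m := integral_const_mul _ _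
    _ ≤ 32 * 2 := by
        gcongr
        rw [integral_eq_lintegral_of_nonneg_ae (ae_of_all _ fun _ => (Real.exp_pos _).le)
          (by fun_prop)]
        exact ENNReal.toReal_le_of_le_ofReal (by norm_num) (lintegral_exp_energy_div_four_le hm)
    _ = 64 := by norm_num

/-- The mean of a nonnegative quadratic polynomial `1 + b p + c p²` of the energy `p`. -/
lemma lintegral_quadratic_energy_le {m : ℕ} (hm : 0 < m) {b c : ℝ} (hc : 0 ≤ c)
    (h : ∀ p : ℝ, 0 ≤ p → 0 ≤ 1 + b * p + c * p ^ 2) :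
    ∫⁻ g, ENNReal.ofReal (1 + b * energy g + c * energy g ^ 2) ∂entryLaw m ≤
      ENNReal.ofReal (1 + b + 64 * c) := by
  have i1 : Integrable (fun g => 1 + b * energy g) (entryLaw m) :=
    (integrable_const 1).add (integrable_energy.const_mul b)
  have i2 : Integrable (fun g => c * energy g ^ 2) (entryLaw m) :=
    (integrable_energy_sq hm).const_mul c
  have i3 : Integrable (fun g => 1 + b * energy g + c * energy g ^ 2) (entryLaw m) := i1.add i2
  rw [← ofReal_integral_eq_lintegral_ofReal i3
    (ae_of_all _ fun g => h _ (energy_nonneg g))]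
  apply ENNReal.ofReal_le_ofReal
  rw [integral_add i1 i2, integral_add (integrable_const 1) (integrable_energy.const_mul b),
    integral_const_mul, integral_const_mul, integral_energy hm]
  have := mul_le_mul_of_nonneg_left (integral_energy_sq_le (m := m) hm) hc
  simp
  linarith

/-- The inner product `⟨Φ_u, Y⟩` for `c = (Φ_u, Y - x Φ_u)`. -/
def response {m : ℕ} (x : ℝ) (c : (Fin m → ℝ) × (Fin m → ℝ)) : ℝ :=
  x * energy c.1 + ∑ a, c.1 a * c.2 a

@[fun_prop]
lemma measurable_response {m : ℕ} (x : ℝ) : Measurable (response (m := m) x) := by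
  unfold response; fun_prop

/-- Given the column `g`, the response is Gaussian with mean `x p` and variance `v p`, where `p`
is the energy of `g`. -/
lemma lintegral_exp_response {m : ℕ} (v : ℝ≥0) (θ x : ℝ) (g : Fin m → ℝ)
    (h : 0 < 1 + 2 * (θ * v * energy g)) :
    ∫⁻ z, ENNReal.ofReal (Real.exp (-θ * response x (g, z) ^ 2))
        ∂(Measure.pi fun _ : Fin m => gaussianReal 0 v) =
      ENNReal.ofReal ((√(1 + 2 * (θ * v * energy g)))⁻¹ *
        Real.exp (-θ * (x * energy g) ^ 2 / (1 + 2 * (θ * v * energy g)))) := by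
  have hlaw := map_linear_pi_gaussianReal v g Finset.univ
  have hvar : ((∑ a, scaledVar (g a) v : ℝ≥0) : ℝ) = v * energy g := by
    simp only [NNReal.coe_sum, coe_scaledVar, energy]
    rw [← Finset.sum_mul, mul_comm]
  have hD : 1 + 2 * θ * ((∑ a, scaledVar (g a) v : ℝ≥0) : ℝ) = 1 + 2 * (θ * v * energy g) := by
    rw [hvar]; ring
  have h1 := lintegral_exp_neg_mul_sq_gaussianReal (∑ a, scaledVar (g a) v) θ (x * energy g)
    (by rw [hD]; exact h)
  rw [← hlaw, lintegral_map (by fun_prop) (by fun_prop), hD] at h1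
  exact h1

/-- Pointwise bound behind the lower tail, with `p = 1` the typical energy: the tangent at `1` to
the convex function `p ↦ p² / (1 + 2 ε p)`, and `1 / (1 + y) ≤ 1 - y + y²`. -/
lemma lower_integrand_le {ε w p : ℝ} (hε : 0 ≤ ε) (hw : 0 ≤ w) (hp : 0 ≤ p) :
    (√(1 + 2 * (ε * p)))⁻¹ * Real.exp (-w * p ^ 2 / (1 + 2 * (ε * p))) ≤
      Real.exp (-ε - w * (1 - 2 * ε)) *
        ((1 / 2) * (Real.exp (2 * ε) * (1 + -(2 * ε) * p + 4 * ε ^ 2 * p ^ 2)) +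
          (1 / 2) * Real.exp (-(2 * w * ((2 + 2 * ε) / (1 + 2 * ε) ^ 2)) * (p - 1))) := by
  set D := 1 + 2 * (ε * p) with hD
  have hεp : 0 ≤ ε * p := by positivity
  have hD0 : 0 < D := by positivity
  set s := (2 + 2 * ε) / (1 + 2 * ε) ^ 2 with hs
  have htan : 1 - 2 * ε + s * (p - 1) ≤ p ^ 2 / D := by
    have e1 : p ^ 2 / D - (1 / (1 + 2 * ε) + s * (p - 1)) =
        (p - 1) ^ 2 / (D * (1 + 2 * ε) ^ 2) := by
      rw [hs, hD]
      have : 1 + 2 * (ε * p) ≠ 0 := hD0.ne'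
      field_simp
      ring
    have e2 : 1 - 2 * ε ≤ 1 / (1 + 2 * ε) := by
      rw [le_div_iff₀ (by positivity)]; nlinarith [sq_nonneg ε]
    have e3 : 0 ≤ (p - 1) ^ 2 / (D * (1 + 2 * ε) ^ 2) := by positivity
    linarith
  have hB : Real.exp (-w * p ^ 2 / D) ≤
      Real.exp (-w * (1 - 2 * ε)) * Real.exp (-(w * s * (p - 1))) := by
    rw [← Real.exp_add]
    apply Real.exp_le_exp.2
    have := mul_le_mul_of_nonneg_left htan hw
    rw [mul_div_assoc]
    linarith
  have hA : ((√D)⁻¹ * Real.exp ε) ^ 2 ≤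
      Real.exp (2 * ε) * (1 + -(2 * ε) * p + 4 * ε ^ 2 * p ^ 2) := by
    rw [mul_pow, inv_pow, Real.sq_sqrt hD0.le, ← Real.exp_nat_mul, mul_comm]
    push_cast
    refine mul_le_mul_of_nonneg_left ?_ (Real.exp_pos _).le
    rw [inv_le_iff_one_le_mul₀ hD0, hD]
    nlinarith [pow_nonneg hεp 3]
  have hBB : Real.exp (-(w * s * (p - 1))) ^ 2 = Real.exp (-(2 * w * s) * (p - 1)) := by
    rw [← Real.exp_nat_mul]; push_cast; ring_nf
  have hAB := two_mul_le_add_sq ((√D)⁻¹ * Real.exp ε) (Real.exp (-(w * s * (p - 1))))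
  calc (√D)⁻¹ * Real.exp (-w * p ^ 2 / D)
      ≤ (√D)⁻¹ * (Real.exp (-w * (1 - 2 * ε)) * Real.exp (-(w * s * (p - 1)))) := by gcongr
    _ = Real.exp (-ε - w * (1 - 2 * ε)) *
        (((√D)⁻¹ * Real.exp ε) * Real.exp (-(w * s * (p - 1)))) := by
        rw [show -ε - w * (1 - 2 * ε) = -w * (1 - 2 * ε) + -ε by ring, Real.exp_add,
          Real.exp_neg ε]
        field_simp
    _ ≤ _ := by
        apply mul_le_mul_of_nonneg_left _ (Real.exp_pos _).le
        rw [← hBB]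
        linarith

/-- Exponential moment for the lower tail on the support. The mean of the squared response is
`v + x² (1 + 2 / m)`; the first-order term here is slightly smaller, and the second-order term has
the size of its variance. -/
lemma lintegral_exp_neg_response_sq_le {m : ℕ} (hm : 0 < m) (v : ℝ≥0) {θ : ℝ} (hθ : 0 ≤ θ) (x : ℝ) :
    ∫⁻ c, ENNReal.ofReal (Real.exp (-θ * response x c ^ 2)) ∂columnLaw m v ≤
      ENNReal.ofReal (Real.exp (-θ * (v + x ^ 2) +
        θ ^ 2 * (2 * v * x ^ 2 + 256 * v ^ 2 + 16 * x ^ 4 / m))) := by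
  have hm' : (0 : ℝ) < m := by exact_mod_cast hm
  set ε := θ * v with hεd
  have hε : 0 ≤ ε := by positivity
  set w := θ * x ^ 2 with hwd
  have hw : 0 ≤ w := by positivity
  set s := (2 + 2 * ε) / (1 + 2 * ε) ^ 2 with hs
  have hs0 : 0 ≤ s := by positivity
  have hs2 : s ≤ 2 := by
    rw [hs, div_le_iff₀ (by positivity)]; nlinarith [sq_nonneg ε]
  have hquad : ∀ p : ℝ, 0 ≤ p → 0 ≤ 1 + -(2 * ε) * p + 4 * ε ^ 2 * p ^ 2 := by
    intro p _; nlinarith [sq_nonneg (2 * ε * p - 1), sq_nonneg (2 * ε * p)]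
  rw [columnLaw, lintegral_prod _ (by fun_prop)]
  change ∫⁻ g, _ ∂entryLaw m ≤ _
  calc ∫⁻ g, ∫⁻ z, ENNReal.ofReal (Real.exp (-θ * response x (g, z) ^ 2))
          ∂(Measure.pi fun _ : Fin m => gaussianReal 0 v) ∂entryLaw m
      ≤ ∫⁻ g, ENNReal.ofReal (Real.exp (-ε - w * (1 - 2 * ε))) *
          (ENNReal.ofReal (1 / 2 * Real.exp (2 * ε)) *
              ENNReal.ofReal (1 + -(2 * ε) * energy g + 4 * ε ^ 2 * energy g ^ 2) +
            ENNReal.ofReal (1 / 2) *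
              ENNReal.ofReal (Real.exp (-(2 * w * s) * (energy g - 1)))) ∂entryLaw m := by
        refine lintegral_mono fun g => ?_
        have hp := energy_nonneg g
        have hεp : 0 ≤ ε * energy g := by positivity
        rw [lintegral_exp_response v θ x g (by positivity)]
        rw [← ENNReal.ofReal_mul (by positivity), ← ENNReal.ofReal_mul (by positivity),
          ← ENNReal.ofReal_add (mul_nonneg (by positivity) (hquad _ hp)) (by positivity),
          ← ENNReal.ofReal_mul (by positivity)]
        apply ENNReal.ofReal_le_ofReal
        have := lower_integrand_le hε hw hp
        rw [show -θ * (x * energy g) ^ 2 = -w * energy g ^ 2 by rw [hwd]; ring]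
        rw [mul_assoc (1 / 2) (Real.exp (2 * ε))]
        exact this
    _ ≤ ENNReal.ofReal (Real.exp (-ε - w * (1 - 2 * ε))) *
          (ENNReal.ofReal (1 / 2 * Real.exp (2 * ε)) *
              ENNReal.ofReal (1 + -(2 * ε) + 64 * (4 * ε ^ 2)) +
            ENNReal.ofReal (1 / 2) * ENNReal.ofReal (Real.exp ((2 * w * s) ^ 2 / m))) := by
        rw [lintegral_const_mul _ (by fun_prop), lintegral_add_left (by fun_prop),
          lintegral_const_mul _ (by fun_prop), lintegral_const_mul _ (by fun_prop)]
        gcongr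
        · exact lintegral_quadratic_energy_le hm (by positivity) hquad
        · exact lintegral_exp_neg_mul_energy_le hm (by positivity)
    _ ≤ _ := by
        have h0 : 0 ≤ 1 + -(2 * ε) + 64 * (4 * ε ^ 2) := by
          have := hquad 1 (by norm_num); nlinarith [sq_nonneg ε]
        rw [← ENNReal.ofReal_mul (by positivity), ← ENNReal.ofReal_mul (by positivity),
          ← ENNReal.ofReal_add (by positivity) (by positivity),
          ← ENNReal.ofReal_mul (by positivity)]
        apply ENNReal.ofReal_le_ofReal
        set A := 256 * ε ^ 2
        set B := 16 * w ^ 2 / m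
        have hA0 : 0 ≤ A := by positivity
        have hB0 : 0 ≤ B := by positivity
        have hA : Real.exp (2 * ε) * (1 + -(2 * ε) + 64 * (4 * ε ^ 2)) ≤ Real.exp (A + B) := by
          have h1 : 1 + -(2 * ε) + 64 * (4 * ε ^ 2) ≤ Real.exp (-(2 * ε) + A) := by
            have := Real.add_one_le_exp (-(2 * ε) + A)
            linarith
          calc _ ≤ Real.exp (2 * ε) * Real.exp (-(2 * ε) + A) := by gcongr
            _ = Real.exp A := by rw [← Real.exp_add]; ring_nf
            _ ≤ _ := by gcongr; linarith
        have hB : Real.exp ((2 * w * s) ^ 2 / m) ≤ Real.exp (A + B) := by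
          apply Real.exp_le_exp.2
          have : (2 * w * s) ^ 2 / m ≤ B := by
            apply div_le_div_of_nonneg_right _ hm'.le
            have : 2 * w * s ≤ 4 * w := by nlinarith
            calc (2 * w * s) ^ 2 ≤ (4 * w) ^ 2 := by gcongr
              _ = _ := by ring
          linarith
        calc _ ≤ Real.exp (-ε - w * (1 - 2 * ε)) * Real.exp (A + B) := by
              gcongr; linarith
          _ = _ := by
              rw [← Real.exp_add]
              congr 1
              simp only [A, B, hεd, hwd]
              ring

lemma inv_sqrt_one_sub_le {y : ℝ} (hy : 0 ≤ y) (hy4 : y ≤ 1 / 4) :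
    (√(1 - 2 * y))⁻¹ ≤ 1 + y + 3 * y ^ 2 := by
  have h1 : 0 < 1 - 2 * y := by linarith
  rw [inv_le_comm₀ (Real.sqrt_pos.2 h1) (by positivity), ← one_div]
  apply Real.le_sqrt_of_sq_le
  rw [div_pow, one_pow, div_le_iff₀ (by positivity)]
  have : 0 ≤ y ^ 2 * (3 - 8 * y - 3 * y ^ 2 - 18 * y ^ 3) := by
    apply mul_nonneg (sq_nonneg _)
    have h2 : y ^ 2 ≤ 1 / 16 := by nlinarith
    have h3 : y ^ 3 ≤ 1 / 64 := by nlinarith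
    linarith
  nlinarith

/-- Exponential moment for the upper tail off the support. The squared response has no exponential
moments, so it is restricted to columns of bounded energy. -/
lemma lintegral_exp_response_sq_le {m : ℕ} (hm : 0 < m) (v : ℝ≥0) {θ T : ℝ} (hθ : 0 ≤ θ)
    (hT : θ * v * T ≤ 1 / 4) :
    ∫⁻ c, {c | energy c.1 ≤ T}.indicator
        (fun c => ENNReal.ofReal (Real.exp (θ * response 0 c ^ 2))) c ∂columnLaw m v ≤
      ENNReal.ofReal (Real.exp (θ * v + 192 * (θ * v) ^ 2)) := by
  set ε := θ * v with hεd
  have hε : 0 ≤ ε := by positivity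
  have hmeas : MeasurableSet {c : (Fin m → ℝ) × (Fin m → ℝ) | energy c.1 ≤ T} :=
    measurableSet_le (by fun_prop) (by fun_prop)
  rw [columnLaw, lintegral_prod _ (Measurable.aemeasurable
    (Measurable.indicator (by fun_prop) hmeas))]
  change ∫⁻ g, _ ∂entryLaw m ≤ _
  calc _ ≤ ∫⁻ g, ENNReal.ofReal (1 + ε * energy g + 3 * ε ^ 2 * energy g ^ 2) ∂entryLaw m := by
        refine lintegral_mono fun g => ?_
        have hp := energy_nonneg g
        have hεp : 0 ≤ ε * energy g := by positivity
        by_cases hg : energy g ≤ T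
        · have h4 : ε * energy g ≤ 1 / 4 := (mul_le_mul_of_nonneg_left hg hε).trans hT
          have h1 : ∀ z : Fin m → ℝ, {c : (Fin m → ℝ) × (Fin m → ℝ) | energy c.1 ≤ T}.indicator
              (fun c => ENNReal.ofReal (Real.exp (θ * response 0 c ^ 2))) (g, z) =
              ENNReal.ofReal (Real.exp (-(-θ) * response 0 (g, z) ^ 2)) := by
            intro z
            rw [Set.indicator_of_mem (by exact hg), neg_neg]
          simp_rw [h1]
          have e1 : 1 + 2 * (-θ * (v : ℝ) * energy g) = 1 - 2 * (ε * energy g) := by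
            rw [hεd]; ring
          rw [lintegral_exp_response v (-θ) 0 g (by rw [e1]; linarith), e1]
          apply ENNReal.ofReal_le_ofReal
          have := inv_sqrt_one_sub_le hεp h4
          simp only [zero_mul, ne_eq, OfNat.ofNat_ne_zero, not_false_eq_true, zero_pow, mul_zero,
            zero_div, Real.exp_zero, mul_one]
          linarith [mul_pow ε (energy g) 2]
        · have h1 : ∀ z : Fin m → ℝ, {c : (Fin m → ℝ) × (Fin m → ℝ) | energy c.1 ≤ T}.indicator
              (fun c => ENNReal.ofReal (Real.exp (θ * response 0 c ^ 2))) (g, z) = 0 := by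
            intro z
            rw [Set.indicator_of_notMem (by exact hg)]
          simp [h1]
    _ ≤ ENNReal.ofReal (1 + ε + 64 * (3 * ε ^ 2)) :=
        lintegral_quadratic_energy_le hm (by positivity) fun p hp => by positivity
    _ ≤ _ := by
        apply ENNReal.ofReal_le_ofReal
        have := Real.add_one_le_exp (ε + 192 * ε ^ 2)
        linarith

/-! ### Chernoff bounds for the sum over the samples -/

lemma lintegral_prod_sampleLaw_le {n m d : ℕ} {σ : ℝ≥0}
    {f : Fin n → (Fin m → (Fin d → ℝ) × ℝ) → ENNReal} (hf : ∀ i, Measurable (f i))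
    {b : Fin n → ℝ} (h : ∀ i, ∫⁻ r, f i r ∂sampleLaw m d σ ≤ ENNReal.ofReal (Real.exp (b i))) :
    ∫⁻ r, ∏ i, f i (r i) ∂(Measure.pi fun _ : Fin n => sampleLaw m d σ) ≤
      ENNReal.ofReal (Real.exp (∑ i, b i)) := by
  have hind : iIndepFun (fun (i : Fin n) (r : Fin n → Fin m → (Fin d → ℝ) × ℝ) => f i (r i))
      (Measure.pi fun _ : Fin n => sampleLaw m d σ) :=
    iIndepFun_pi (μ := fun _ : Fin n => sampleLaw m d σ) fun i => (hf i).aemeasurable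
  rw [lintegral_prod_eq_prod_lintegral_of_indepFun _ _ hind
    fun i => (hf i).comp (measurable_pi_apply i), Real.exp_sum,
    ENNReal.ofReal_prod_of_nonneg fun _ _ => (Real.exp_pos _).le]
  refine Finset.prod_le_prod' fun i _ => ?_
  have := (measurePreserving_eval (fun _ : Fin n => sampleLaw m d σ) i).lintegral_comp (hf i)
  exact this.trans_le (h i)

@[fun_prop]
lemma measurable_splitColumn {m d : ℕ} (x : Fin d → ℝ) (u : Fin d) :
    Measurable (splitColumn (m := m) x u) := by
  unfold splitColumn; fun_prop

/-- The inner product `⟨Φ_u, Y⟩` of one sample with input `x`. -/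
def sampleResponse {m d : ℕ} (x : Fin d → ℝ) (u : Fin d) (r : Fin m → (Fin d → ℝ) × ℝ) : ℝ :=
  response (x u) (splitColumn x u r)

@[fun_prop]
lemma measurable_sampleResponse {m d : ℕ} (x : Fin d → ℝ) (u : Fin d) :
    Measurable (sampleResponse (m := m) x u) := by
  unfold sampleResponse; fun_prop

lemma secondMoment_assemble {n m d : ℕ} (x : Fin n → Fin d → ℝ)
    (r : Fin n → Fin m → (Fin d → ℝ) × ℝ) (u : Fin d) :
    secondMoment (measurements x (assemble r).1 (assemble r).2) (assemble r).1 u =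
      (1 / (n : ℝ)) * ∑ i, sampleResponse (x i) u (r i) ^ 2 := by
  unfold secondMoment
  congr 1
  refine Finset.sum_congr rfl fun i _ => ?_
  congr 1
  simp only [sampleResponse, response, splitColumn, energy, measurements, assemble]
  rw [Finset.mul_sum, ← Finset.sum_add_distrib]
  refine Finset.sum_congr rfl fun a _ => ?_
  rw [← Finset.add_sum_erase _ _ (Finset.mem_univ u)]
  have : ∑ j ∈ Finset.univ.erase u, (r i a).1 j * x i j =
      ∑ j ∈ Finset.univ.erase u, x i j * (r i a).1 j :=
    Finset.sum_congr rfl fun j _ => mul_comm _ _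
  rw [this]
  ring

lemma measure_sum_sq_le {n m d : ℕ} (hm : 0 < m) (σ : ℝ≥0) (x : Fin n → Fin d → ℝ) (u : Fin d)
    {θ : ℝ} (hθ : 0 ≤ θ) (t : ℝ) :
    (Measure.pi fun _ : Fin n => sampleLaw m d σ)
        {r | ∑ i, sampleResponse (x i) u (r i) ^ 2 ≤ t} ≤
      ENNReal.ofReal (Real.exp (θ * t + ∑ i, (-θ * (crossVar m σ (x i) u + x i u ^ 2) +
        θ ^ 2 * (2 * crossVar m σ (x i) u * x i u ^ 2 + 256 * (crossVar m σ (x i) u : ℝ) ^ 2 +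
          16 * x i u ^ 4 / m)))) := by
  set f : Fin n → (Fin m → (Fin d → ℝ) × ℝ) → ENNReal :=
    fun i r => ENNReal.ofReal (Real.exp (-θ * sampleResponse (x i) u r ^ 2)) with hf
  have hfm : ∀ i, Measurable (f i) := fun i => by simp only [hf]; fun_prop
  have h1 := lintegral_prod_sampleLaw_le (σ := σ) hfm (b := fun i =>
    -θ * (crossVar m σ (x i) u + x i u ^ 2) +
        θ ^ 2 * (2 * crossVar m σ (x i) u * x i u ^ 2 + 256 * (crossVar m σ (x i) u : ℝ) ^ 2 +
          16 * x i u ^ 4 / m)) fun i => by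
    have h2 := (measurePreserving_splitColumn (m := m) σ (x i) u).lintegral_comp
      (f := fun c => ENNReal.ofReal (Real.exp (-θ * response (x i u) c ^ 2))) (by fun_prop)
    exact h2.trans_le (lintegral_exp_neg_response_sq_le hm _ hθ _)
  have h3 := meas_ge_le_lintegral_div (μ := Measure.pi fun _ : Fin n => sampleLaw m d σ)
    (f := fun r => ∏ i, f i (r i)) (Measurable.aemeasurable (by fun_prop))
    (ε := ENNReal.ofReal (Real.exp (-θ * t))) (by simp [Real.exp_pos]) ENNReal.ofReal_ne_top
  refine (measure_mono fun r hr => ?_).trans (h3.trans ((ENNReal.div_le_div_right h1 _).trans ?_))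
  · simp only [hf, Set.mem_ofPred_eq] at hr ⊢
    rw [← ENNReal.ofReal_prod_of_nonneg fun _ _ => (Real.exp_pos _).le, ← Real.exp_sum,
      ← Finset.mul_sum]
    apply ENNReal.ofReal_le_ofReal
    apply Real.exp_le_exp.2
    have := mul_le_mul_of_nonneg_left hr hθ
    linarith
  · rw [← ENNReal.ofReal_div_of_pos (Real.exp_pos _), ← Real.exp_sub]
    apply le_of_eq
    congr 2
    ring

/-- The energies of the columns are truncated at `T`, at the cost of a union bound over the
samples. -/
lemma measure_le_sum_sq {n m d : ℕ} (hm : 0 < m) (σ : ℝ≥0) (x : Fin n → Fin d → ℝ) (u : Fin d)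
    (hu : ∀ i, x i u = 0) {θ T : ℝ} (hθ : 0 ≤ θ) (hT3 : 3 ≤ T)
    (hT : ∀ i, θ * crossVar m σ (x i) u * T ≤ 1 / 4) (t : ℝ) :
    (Measure.pi fun _ : Fin n => sampleLaw m d σ)
        {r | t ≤ ∑ i, sampleResponse (x i) u (r i) ^ 2} ≤
      ENNReal.ofReal (Real.exp (-θ * t + ∑ i, (θ * crossVar m σ (x i) u +
        192 * (θ * crossVar m σ (x i) u) ^ 2)) + n * Real.exp (-(m * T / 8))) := by
  set P := Measure.pi fun _ : Fin n => sampleLaw m d σ with hP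
  set F : (Fin m → ℝ) × (Fin m → ℝ) → ENNReal := {c | energy c.1 ≤ T}.indicator
    (fun c => ENNReal.ofReal (Real.exp (θ * response 0 c ^ 2))) with hF
  have hFm : Measurable F := Measurable.indicator (by fun_prop)
    (measurableSet_le (by fun_prop) (by fun_prop))
  have h1 := lintegral_prod_sampleLaw_le (σ := σ) (f := fun i r => F (splitColumn (x i) u r))
    (b := fun i => θ * crossVar m σ (x i) u + 192 * (θ * crossVar m σ (x i) u) ^ 2)
    (fun i => by fun_prop) fun i => by
    have h2 := (measurePreserving_splitColumn (m := m) σ (x i) u).lintegral_comp hFm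
    exact h2.trans_le (lintegral_exp_response_sq_le hm _ hθ (hT i))
  have h3 := meas_ge_le_lintegral_div (μ := P)
    (f := fun r => ∏ i, F (splitColumn (x i) u (r i))) (Measurable.aemeasurable (by fun_prop))
    (ε := ENNReal.ofReal (Real.exp (θ * t))) (by simp [Real.exp_pos]) ENNReal.ofReal_ne_top
  have htail : ∀ i, P {r | T < energy (splitColumn (x i) u (r i)).1} ≤
      ENNReal.ofReal (Real.exp (-(m * T / 8))) := by
    intro i
    have hmp := ((measurePreserving_fst (μ := entryLaw m)
      (ν := Measure.pi fun _ : Fin m => gaussianReal 0 (crossVar m σ (x i) u))).comp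
      (measurePreserving_splitColumn (m := m) σ (x i) u)).comp
      (measurePreserving_eval (fun _ : Fin n => sampleLaw m d σ) i)
    have hms : MeasurableSet {g : Fin m → ℝ | T < energy g} :=
      measurableSet_lt (by fun_prop) (by fun_prop)
    exact (hmp.measure_preimage hms.nullMeasurableSet).trans_le (measure_energy_gt_le hm hT3)
  have hsub : {r : Fin n → Fin m → (Fin d → ℝ) × ℝ |
      t ≤ ∑ i, sampleResponse (x i) u (r i) ^ 2} ⊆
      {r | ENNReal.ofReal (Real.exp (θ * t)) ≤ ∏ i, F (splitColumn (x i) u (r i))} ∪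
        ⋃ i, {r | T < energy (splitColumn (x i) u (r i)).1} := by
    intro r hr
    by_cases hex : ∃ i, T < energy (splitColumn (x i) u (r i)).1
    · right; simpa using hex
    · left
      push Not at hex
      simp only [Set.mem_ofPred_eq] at hr ⊢
      have e1 : ∀ i, F (splitColumn (x i) u (r i)) =
          ENNReal.ofReal (Real.exp (θ * sampleResponse (x i) u (r i) ^ 2)) := by
        intro i
        rw [hF, Set.indicator_of_mem (by exact hex i), sampleResponse, hu i]
      simp_rw [e1]
      rw [← ENNReal.ofReal_prod_of_nonneg fun _ _ => (Real.exp_pos _).le, ← Real.exp_sum,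
        ← Finset.mul_sum]
      apply ENNReal.ofReal_le_ofReal
      apply Real.exp_le_exp.2
      exact mul_le_mul_of_nonneg_left hr hθ
  rw [ENNReal.ofReal_add (Real.exp_pos _).le (by positivity)]
  refine (measure_mono hsub).trans ((measure_union_le _ _).trans (add_le_add ?_ ?_))
  · refine h3.trans ((ENNReal.div_le_div_right h1 _).trans ?_)
    rw [← ENNReal.ofReal_div_of_pos (Real.exp_pos _), ← Real.exp_sub]
    apply le_of_eq
    congr 2
    ring
  · refine (measure_iUnion_le _).trans ?_
    rw [tsum_fintype]
    refine (Finset.sum_le_sum fun i _ => htail i).trans ?_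
    rw [Finset.sum_const, Finset.card_univ, Fintype.card_fin, nsmul_eq_mul,
      ENNReal.ofReal_mul (by positivity), ENNReal.ofReal_natCast]

/-! ### Separation of the two groups of coordinates -/

/-- The variance `‖x‖² / m + σ²` of the entries of the measurement of `x`. -/
noncomputable def measurementVar (m : ℕ) {d : ℕ} (σ : ℝ≥0) (x : Fin d → ℝ) : ℝ :=
  (∑ j, x j ^ 2) / m + (σ : ℝ) ^ 2

lemma measurementVar_le {m d : ℕ} (σ : ℝ≥0) {S : Finset (Fin d)} {xmin xmax : ℝ}
    {x : Fin d → ℝ} (hsupp : Function.support x = (S : Set (Fin d)))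
    (hx : ∀ u ∈ S, |x u| ∈ Set.Icc xmin xmax) :
    measurementVar m σ x ≤ S.card * xmax ^ 2 / m + (σ : ℝ) ^ 2 := by
  unfold measurementVar
  gcongr
  rw [← Finset.sum_subset (Finset.subset_univ S) fun j _ hj => ?_]
  · rw [← nsmul_eq_mul]
    refine Finset.sum_le_card_nsmul _ _ _ fun j hj => ?_
    rw [← sq_abs]
    exact pow_le_pow_left₀ (abs_nonneg _) (hx j hj).2 2
  · have : j ∉ Function.support x := by rw [hsupp]; exact_mod_cast hj
    rw [Function.notMem_support.1 this]; norm_num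

/-- Numerical form of the lower tail: `a = xmin²`, `b = xmax²`, `q` bounds the measurement
variances, `L = log (d / δ)`, and `s i`, `y i` are the measurement variance and the squared input at
the coordinate. -/
lemma lower_exponent_le {n m : ℕ} {a b q L θ : ℝ} {v y s : Fin n → ℝ} (hn : 0 < n) (hm : 2 ≤ m)
    (ha : 0 < a) (hq : 0 < q) (hL : 0 < L) (hbm : b / m ≤ q)
    (h1 : 10 ^ 8 * L * (b * q) ≤ n * a ^ 2) (h2 : 10 ^ 8 * L * q ^ 2 ≤ n * a ^ 2)
    (hθ : θ = 16 * L / (n * a)) (hy : ∀ i, a ≤ y i) (hyb : ∀ i, y i ≤ b)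
    (hs : ∀ i, s i ≤ q) (hv0 : ∀ i, 0 ≤ v i) (hv : ∀ i, v i = s i - y i / m) :
    θ * (∑ i, s i + n * a / 4) + ∑ i, (-θ * (v i + y i) +
      θ ^ 2 * (2 * v i * y i + 256 * v i ^ 2 + 16 * y i ^ 2 / m)) ≤ -L := by
  have hn' : (0 : ℝ) < n := by exact_mod_cast hn
  have hm' : (2 : ℝ) ≤ m := by exact_mod_cast hm
  have hm0 : (0 : ℝ) < m := by linarith
  have hθ0 : 0 < θ := by rw [hθ]; positivity
  have hθn : θ * (n * a) = 16 * L := by rw [hθ]; field_simp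
  have hterm : ∀ i, -θ * (v i + y i) +
      θ ^ 2 * (2 * v i * y i + 256 * v i ^ 2 + 16 * y i ^ 2 / m) ≤
      -θ * s i + (-θ * (a / 2) + θ ^ 2 * (18 * (b * q) + 256 * q ^ 2)) := by
    intro i
    have hy0 : 0 < y i := ha.trans_le (hy i)
    have hb0 : 0 < b := hy0.trans_le (hyb i)
    have e1 : y i / m ≤ y i / 2 := by gcongr
    have e0 : 0 ≤ y i / m := by positivity
    have e2 : v i ≤ q := by rw [hv i]; linarith [hs i]
    have e3 : s i + a / 2 ≤ v i + y i := by rw [hv i]; linarith [hy i]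
    have e4 : y i ^ 2 / m ≤ b * q := by
      calc y i ^ 2 / m = y i * (y i / m) := by ring
        _ ≤ b * (b / m) := by
            have := hyb i
            gcongr
        _ ≤ b * q := by gcongr
    have e5 : v i * y i ≤ b * q := by
      rw [mul_comm]; exact mul_le_mul (hyb i) e2 (hv0 i) hb0.le
    have e6 : v i ^ 2 ≤ q ^ 2 := pow_le_pow_left₀ (hv0 i) e2 2
    have e7 := mul_le_mul_of_nonneg_left e3 hθ0.le
    have e8 : θ ^ 2 * (2 * v i * y i + 256 * v i ^ 2 + 16 * y i ^ 2 / m) ≤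
        θ ^ 2 * (18 * (b * q) + 256 * q ^ 2) := by
      apply mul_le_mul_of_nonneg_left _ (sq_nonneg θ)
      rw [mul_div_assoc]
      linarith
    linarith
  have hsum := Finset.sum_le_sum fun i (_ : i ∈ Finset.univ) => hterm i
  have hR : ∑ i, (-θ * s i + (-θ * (a / 2) + θ ^ 2 * (18 * (b * q) + 256 * q ^ 2))) =
      -θ * ∑ i, s i + n * (-θ * (a / 2) + θ ^ 2 * (18 * (b * q) + 256 * q ^ 2)) := by
    rw [Finset.sum_add_distrib, ← Finset.mul_sum, Finset.sum_const, Finset.card_univ,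
      Fintype.card_fin, nsmul_eq_mul]
  rw [hR] at hsum
  have hV : n * (θ ^ 2 * (18 * (b * q) + 256 * q ^ 2)) ≤ L := by
    have e1 : n * (θ ^ 2 * (18 * (b * q) + 256 * q ^ 2)) =
        256 * L * (L * (18 * (b * q) + 256 * q ^ 2)) / (n * a ^ 2) := by
      rw [hθ]; field_simp; ring
    rw [e1, div_le_iff₀ (by positivity)]
    have e2 : 256 * (L * (18 * (b * q) + 256 * q ^ 2)) ≤ n * a ^ 2 := by nlinarith
    nlinarith
  nlinarith

/-- Numerical form of the upper tail. The truncation level is `T = 1 / (4 θ q)`; the union bound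
over the `n` samples is affordable because `L T` is at least of order `√n`. -/
lemma upper_bound_le {n m : ℕ} {a b q L θ T : ℝ} {v : Fin n → ℝ} (hn : 0 < n)
    (ha : 0 < a) (hab : a ≤ b) (hq : 0 < q) (hL : Real.log 2 ≤ L) (hmL : 2 * L ≤ m)
    (h1 : 10 ^ 8 * L * (b * q) ≤ n * a ^ 2) (h2 : 10 ^ 8 * L * q ^ 2 ≤ n * a ^ 2)
    (hθ : θ = 16 * L / (n * a)) (hT : T = n * a / (64 * L * q))
    (hv0 : ∀ i, 0 ≤ v i) (hvq : ∀ i, v i ≤ q) :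
    3 ≤ T ∧ (∀ i, θ * v i * T ≤ 1 / 4) ∧
    Real.exp (-θ * (∑ i, v i + n * a / 4) + ∑ i, (θ * v i + 192 * (θ * v i) ^ 2)) +
      n * Real.exp (-(m * T / 8)) ≤ Real.exp (-L) := by
  have hn' : (0 : ℝ) < n := by exact_mod_cast hn
  have hn1 : (1 : ℝ) ≤ n := by exact_mod_cast hn
  have hlog2 := Real.log_two_gt_d9
  have hL0 : 0 < L := by linarith
  have hθ0 : 0 < θ := by rw [hθ]; positivity
  have hθn : θ * (n * a) = 16 * L := by rw [hθ]; field_simp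
  have hT16 : 16 ≤ T := by
    rw [hT, le_div_iff₀ (by positivity)]
    have e1 : 10 ^ 8 * L * (a * q) ≤ n * a ^ 2 := le_trans (by gcongr) h1
    have e2 : a * (10 ^ 8 * L * q) ≤ a * (n * a) := by linarith
    have e3 := le_of_mul_le_mul_left e2 ha
    have : 0 < L * q := by positivity
    linarith
  have hθqT : θ * q * T = 1 / 4 := by
    rw [hθ, hT]; field_simp; norm_num
  refine ⟨by linarith, fun i => ?_, ?_⟩
  · rw [← hθqT]; gcongr; exact hvq i
  have hterm : ∀ i, θ * v i + 192 * (θ * v i) ^ 2 ≤ θ * v i + 192 * (θ * q) ^ 2 := by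
    intro i
    have := hvq i
    have := hv0 i
    gcongr
  have hsum := Finset.sum_le_sum fun i (_ : i ∈ Finset.univ) => hterm i
  rw [Finset.sum_add_distrib, Finset.sum_add_distrib, ← Finset.mul_sum, Finset.sum_const,
    Finset.card_univ, Fintype.card_fin, nsmul_eq_mul] at hsum
  have hV : n * (192 * (θ * q) ^ 2) ≤ L := by
    have e1 : n * (192 * (θ * q) ^ 2) = 192 * 256 * L * (L * q ^ 2) / (n * a ^ 2) := by
      rw [hθ]; field_simp; ring
    rw [e1, div_le_iff₀ (by positivity)]
    have e2 : 192 * 256 * (L * q ^ 2) ≤ n * a ^ 2 := by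
      have : 0 < L * q ^ 2 := by positivity
      linarith
    calc _ = L * (192 * 256 * (L * q ^ 2)) := by ring
      _ ≤ _ := by gcongr
  have hexp1 : -θ * (∑ i, v i + n * a / 4) + ∑ i, (θ * v i + 192 * (θ * v i) ^ 2) ≤ -L - L := by
    rw [Finset.sum_add_distrib, ← Finset.mul_sum]
    nlinarith
  have hhalf : Real.exp (-L) ≤ 1 / 2 := by
    calc Real.exp (-L) ≤ Real.exp (-Real.log 2) := by gcongr
      _ = 1 / 2 := by rw [Real.exp_neg, Real.exp_log (by norm_num)]; norm_num
  have hLT : √(n : ℝ) ≤ L * T / 8 := by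
    apply Real.sqrt_le_iff.2 ⟨by positivity, ?_⟩
    have e1 : L * T / 8 = n * a / (512 * q) := by rw [hT]; field_simp; norm_num
    rw [e1, div_pow, le_div_iff₀ (by positivity)]
    have e2 : n * (10 ^ 8 * L * q ^ 2) ≤ n * (n * a ^ 2) := by gcongr
    have e3 : 0 < n * q ^ 2 := by positivity
    nlinarith
  have hlogn : (n : ℝ) ≤ Real.exp (L * T / 8) := by
    have hs0 : 0 ≤ √(n : ℝ) := Real.sqrt_nonneg _
    have hss := Real.sq_sqrt hn'.le
    -- `s² ≤ exp s` for `s ≥ 0`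
    have e1 : √(n : ℝ) / 2 + 1 ≤ Real.exp (√(n : ℝ) / 2) := Real.add_one_le_exp _
    have e2 := Real.quadratic_le_exp_of_nonneg (x := √(n : ℝ) / 2) (by positivity)
    have e3 : √(n : ℝ) ≤ Real.exp (√(n : ℝ) / 2) := by nlinarith [sq_nonneg (√(n : ℝ) / 2 - 1)]
    calc (n : ℝ) = √(n : ℝ) ^ 2 := hss.symm
      _ ≤ Real.exp (√(n : ℝ) / 2) ^ 2 := by gcongr
      _ = Real.exp (√(n : ℝ)) := by rw [← Real.exp_nat_mul]; push_cast; ring_nf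
      _ ≤ _ := by gcongr
  have hexp2 : n * Real.exp (-(m * T / 8)) ≤ Real.exp (-L - L) := by
    calc n * Real.exp (-(m * T / 8)) ≤ Real.exp (L * T / 8) * Real.exp (-(m * T / 8)) := by gcongr
      _ = Real.exp (L * T / 8 - m * T / 8) := by rw [← Real.exp_add]; ring_nf
      _ ≤ _ := by
        apply Real.exp_le_exp.2
        have e1 : 2 * L * T ≤ m * T := by gcongr
        have e2 : L * 16 ≤ L * T := by gcongr
        linarith
  calc _ ≤ Real.exp (-L - L) + Real.exp (-L - L) := by gcongr
    _ = 2 * (Real.exp (-L) * Real.exp (-L)) := by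
        rw [show -L - L = -L + -L by ring, Real.exp_add]; ring
    _ ≤ _ := by nlinarith [Real.exp_pos (-L)]

/-- The deterministic threshold: the mean of the second moments off the support, plus a quarter of
the smallest squared input. -/
noncomputable def separatingThreshold {n d : ℕ} (m : ℕ) (σ : ℝ≥0) (xmin : ℝ)
    (x : Fin n → Fin d → ℝ) : ℝ :=
  (1 / (n : ℝ)) * (∑ i, measurementVar m σ (x i) + n * xmin ^ 2 / 4)

/-- The data for which coordinate `u` falls on the wrong side of the threshold. -/
def misplaced {n m d : ℕ} (τ : ℝ) (S : Finset (Fin d)) (x : Fin n → Fin d → ℝ) (u : Fin d) :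
    Set ((Fin n × Fin m × Fin d → ℝ) × (Fin n × Fin m → ℝ)) :=
  {ω | ¬(τ ≤ secondMoment (measurements x ω.1 ω.2) ω.1 u ↔ u ∈ S)}

lemma measurableSet_misplaced {n m d : ℕ} (τ : ℝ) (S : Finset (Fin d)) (x : Fin n → Fin d → ℝ)
    (u : Fin d) : MeasurableSet (misplaced (m := m) τ S x u) := by
  have h : Measurable fun ω : (Fin n × Fin m × Fin d → ℝ) × (Fin n × Fin m → ℝ) =>
      secondMoment (measurements x ω.1 ω.2) ω.1 u := by
    unfold secondMoment measurements; fun_prop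
  exact (h (measurableSet_Ici (a := τ)) |>.iff (MeasurableSet.const _)).compl

/-- Each coordinate is misplaced with probability at most `exp (-L)`, which is `δ / d` when
`L = log (d / δ)`; here `q` bounds the variances of the measurements. -/
lemma measure_misplaced_le {n m k d : ℕ} {xmin xmax : ℝ} {σ : ℝ≥0} {L q : ℝ} (hn : 0 < n)
    (hm : 2 ≤ m) (hk : 0 < k) (hxmin : 0 < xmin) (hx : xmin ≤ xmax)
    (hL : Real.log 2 ≤ L) (hmL : 2 * L ≤ m) (hqd : q = k * xmax ^ 2 / m + (σ : ℝ) ^ 2)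
    (h1 : 10 ^ 8 * L * (xmax ^ 2 * q) ≤ n * (xmin ^ 2) ^ 2)
    (h2 : 10 ^ 8 * L * q ^ 2 ≤ n * (xmin ^ 2) ^ 2)
    {S : Finset (Fin d)} (hS : S.card = k) {x : Fin n → Fin d → ℝ}
    (hadm : AdmissibleInputs S xmin xmax x) (u : Fin d) :
    ensembleLaw n m d σ (misplaced (separatingThreshold m σ xmin x) S x u) ≤
      ENNReal.ofReal (Real.exp (-L)) := by
  have hn' : (0 : ℝ) < n := by exact_mod_cast hn
  have hm' : (0 : ℝ) < m := by exact_mod_cast (by omega : 0 < m)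
  have hk' : (1 : ℝ) ≤ k := by exact_mod_cast hk
  have hlog2 := Real.log_two_gt_d9
  have hL0 : 0 < L := by linarith
  have hxmax : 0 < xmax := hxmin.trans_le hx
  have hbm : xmax ^ 2 / m ≤ q := by
    rw [hqd, mul_div_assoc]
    have : 0 ≤ xmax ^ 2 / m := by positivity
    nlinarith [sq_nonneg (σ : ℝ)]
  have hq : 0 < q := lt_of_lt_of_le (by positivity) hbm
  have hs : ∀ i, measurementVar m σ (x i) ≤ q := fun i => by
    have := measurementVar_le (m := m) σ (hadm i).1 (hadm i).2
    rwa [hS, ← hqd] at this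
  have hcross : ∀ i, (crossVar m σ (x i) u : ℝ) = measurementVar m σ (x i) - x i u ^ 2 / m :=
    fun i => coe_crossVar m σ (x i) u
  have hiff : ∀ r : Fin n → Fin m → (Fin d → ℝ) × ℝ,
      separatingThreshold m σ xmin x ≤
          secondMoment (measurements x (assemble r).1 (assemble r).2) (assemble r).1 u ↔
        ∑ i, measurementVar m σ (x i) + n * xmin ^ 2 / 4 ≤
          ∑ i, sampleResponse (x i) u (r i) ^ 2 := by
    intro r
    rw [secondMoment_assemble, separatingThreshold]
    exact mul_le_mul_iff_of_pos_left (by positivity)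
  rw [← (measurePreserving_assemble n m d σ).measure_preimage
    (measurableSet_misplaced _ S x u).nullMeasurableSet]
  by_cases hu : u ∈ S
  · have hsub : assemble ⁻¹' misplaced (separatingThreshold m σ xmin x) S x u ⊆
        {r : Fin n → Fin m → (Fin d → ℝ) × ℝ | ∑ i, sampleResponse (x i) u (r i) ^ 2 ≤
          ∑ i, measurementVar m σ (x i) + n * xmin ^ 2 / 4} := by
      intro r hr
      simp only [misplaced, Set.mem_preimage, Set.mem_ofPred_eq, hu, iff_true] at hr
      rw [hiff, not_le] at hr
      exact hr.le
    refine (measure_mono hsub).trans ((measure_sum_sq_le (by omega) σ x u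
      (θ := 16 * L / (n * xmin ^ 2)) (by positivity) _).trans ?_)
    apply ENNReal.ofReal_le_ofReal
    apply Real.exp_le_exp.2
    have hsq : ∀ i, x i u ^ 4 = (x i u ^ 2) ^ 2 := fun i => by ring
    simp only [hsq]
    exact lower_exponent_le hn hm (by positivity) hq hL0 hbm h1 h2 rfl
      (fun i => by
        rw [← sq_abs (x i u)]; exact pow_le_pow_left₀ hxmin.le ((hadm i).2 u hu).1 2)
      (fun i => by
        rw [← sq_abs (x i u)]; exact pow_le_pow_left₀ (abs_nonneg _) ((hadm i).2 u hu).2 2)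
      hs (fun i => NNReal.coe_nonneg _) hcross
  · have hx0 : ∀ i, x i u = 0 := fun i => by
      have : u ∉ Function.support (x i) := by rw [(hadm i).1]; exact_mod_cast hu
      exact Function.notMem_support.1 this
    have hv : ∀ i, measurementVar m σ (x i) = crossVar m σ (x i) u := fun i => by
      rw [hcross, hx0]; simp
    obtain ⟨hT3, hT, hfin⟩ := upper_bound_le (v := fun i => (crossVar m σ (x i) u : ℝ)) hn
      (by positivity : 0 < xmin ^ 2) (pow_le_pow_left₀ hxmin.le hx 2) hq hL hmL h1 h2 rfl rfl
      (fun i => NNReal.coe_nonneg _) (fun i => by rw [← hv]; exact hs i)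
    have hsub : assemble ⁻¹' misplaced (separatingThreshold m σ xmin x) S x u ⊆
        {r : Fin n → Fin m → (Fin d → ℝ) × ℝ |
          ∑ i, (crossVar m σ (x i) u : ℝ) + n * xmin ^ 2 / 4 ≤
            ∑ i, sampleResponse (x i) u (r i) ^ 2} := by
      intro r hr
      simp only [misplaced, Set.mem_preimage, Set.mem_ofPred_eq, hiff, hu, iff_false,
        not_not, hv] at hr
      exact hr
    exact (measure_mono hsub).trans ((measure_le_sum_sq (by omega) σ x u hx0 (by positivity)
      hT3 hT _).trans (ENNReal.ofReal_le_ofReal hfin))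

/-- Values separated by a threshold are ordered correctly, so ties play no role. -/
lemma largest_eq_of_separated {d k : ℕ} (hk : k ≤ d) {S : Finset (Fin d)} (hS : S.card = k)
    {l : Fin d → ℝ} {τ : ℝ} (h : ∀ u, τ ≤ l u ↔ u ∈ S) : largest k l = S := by
  symm
  apply Finset.eq_of_subset_of_card_le _ (by rw [card_largest hk, hS])
  intro u hu
  simp only [largest, Finset.mem_filter, Finset.mem_univ, true_and]
  rw [← hS]
  apply Finset.card_lt_card
  rw [Finset.ssubset_iff_of_subset]
  · exact ⟨u, hu, by simp⟩
  · intro v hv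
    simp only [Finset.mem_filter, Finset.mem_univ, true_and] at hv
    rw [← h] at hu ⊢
    rcases hv with hv | hv
    · exact hu.trans hv.le
    · exact hu.trans hv.1.ge

lemma errorProb_le_of_misplaced {n m d : ℕ} {σ : ℝ≥0} {δ ε τ : ℝ} (hδ : d * ε ≤ δ) (hε : 0 ≤ ε)
    {S : Finset (Fin d)} {x : Fin n → Fin d → ℝ}
    (hmis : ∀ u, ensembleLaw n m d σ (misplaced τ S x u) ≤ ENNReal.ofReal ε)
    {g : (Fin n × Fin m → ℝ) → (Fin n × Fin m × Fin d → ℝ) → Finset (Fin d)}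
    (hg : ∀ Y Φ, (∀ u, τ ≤ secondMoment Y Φ u ↔ u ∈ S) → g Y Φ = S) :
    errorProb σ g S x ≤ δ := by
  have hsub : {ω : (Fin n × Fin m × Fin d → ℝ) × (Fin n × Fin m → ℝ) |
      g (measurements x ω.1 ω.2) ω.1 ≠ S} ⊆ ⋃ u, misplaced τ S x u := by
    intro ω hω
    by_contra hcon
    simp only [misplaced, Set.mem_iUnion, Set.mem_ofPred_eq, not_exists, not_not] at hcon
    exact hω (hg _ _ hcon)
  refine ENNReal.toReal_le_of_le_ofReal (le_trans (by positivity) hδ) ?_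
  calc _ ≤ ∑ u, ensembleLaw n m d σ (misplaced τ S x u) :=
        (measure_mono hsub).trans ((measure_iUnion_le _).trans_eq (tsum_fintype _))
    _ ≤ ∑ _u : Fin d, ENNReal.ofReal ε := Finset.sum_le_sum fun u _ => hmis u
    _ = ENNReal.ofReal (d * ε) := by
        rw [Finset.sum_const, Finset.card_univ, Fintype.card_fin, nsmul_eq_mul,
          ENNReal.ofReal_mul (by positivity), ENNReal.ofReal_natCast]
    _ ≤ _ := ENNReal.ofReal_le_ofReal hδ

/-- `sampleBound` in the two forms in which it is used: `b q L / a²` and `q² L / a²`, where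
`a = xmin²`, `b = xmax²` and `q = k b / m + σ²`. -/
lemma le_of_sampleBound_le {m k d : ℕ} {xmin xmax : ℝ} {σ : ℝ≥0} {δ C N : ℝ} (hC : 0 ≤ C)
    (hxmin : 0 < xmin) (hxmax : 0 < xmax) (h : C * sampleBound m k d xmin xmax σ δ ≤ N) :
    C * Real.log (d / δ) * (xmax ^ 2 * (k * xmax ^ 2 / m + (σ : ℝ) ^ 2)) ≤ N * (xmin ^ 2) ^ 2 ∧
    C * Real.log (d / δ) * (k * xmax ^ 2 / m + (σ : ℝ) ^ 2) ^ 2 ≤ N * (xmin ^ 2) ^ 2 := by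
  set r := (k : ℝ) / m + (σ : ℝ) ^ 2 / xmax ^ 2 with hr
  have hq : k * xmax ^ 2 / m + (σ : ℝ) ^ 2 = xmax ^ 2 * r := by rw [hr]; field_simp
  have key : ∀ A, A ≤ max (r * Real.log (d / δ)) (r ^ 2 * Real.log (d / δ)) →
      C * (xmax ^ 4 * A) ≤ N * (xmin ^ 2) ^ 2 := by
    intro A hA
    have h1 : C * (xmax ^ 4 / xmin ^ 4 * A) ≤ N := by
      refine le_trans ?_ h
      unfold sampleBound
      gcongr
    have h2 : C * (xmax ^ 4 / xmin ^ 4 * A) * xmin ^ 4 = C * (xmax ^ 4 * A) := by field_simp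
    rw [← h2]
    calc _ ≤ N * xmin ^ 4 := by gcongr
      _ = _ := by ring
  rw [hq]
  constructor
  · refine le_trans (le_of_eq ?_) (key _ (le_max_left _ _)); ring
  · refine le_trans (le_of_eq ?_) (key _ (le_max_right _ _)); ring

lemma recovers_of_sampleBound_le {n m k d : ℕ} {xmin xmax : ℝ} {σ : ℝ≥0} {δ : ℝ} (hk : 0 < k)
    (hkd : k ≤ d) (hd : 2 ≤ d) (hxmin : 0 < xmin) (hx : xmin ≤ xmax) (hδ : 0 < δ) (hδ1 : δ < 1)
    (hmL : 2 * Real.log (d / δ) ≤ m) (h : 10 ^ 8 * sampleBound m k d xmin xmax σ δ ≤ n) :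
    Recovers (closedFormEstimator n m hkd) xmin xmax σ δ ∧
      ∀ S : Finset (Fin d), S.card = k → ∀ x : Fin n → Fin d → ℝ, AdmissibleInputs S xmin xmax x →
        ∃ τ : ℝ, errorProb (m := m) σ (thresholdSet τ) S x ≤ δ := by
  have hd' : (2 : ℝ) ≤ d := by exact_mod_cast hd
  have hd0 : (0 : ℝ) < d := by linarith
  have hxmax := hxmin.trans_le hx
  have hdδ : 2 ≤ d / δ := by rw [le_div_iff₀ hδ]; linarith
  have hL : Real.log 2 ≤ Real.log (d / δ) := Real.log_le_log (by norm_num) hdδ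
  have hlog2 := Real.log_two_gt_d9
  have hm : 2 ≤ m := by
    have : (1 : ℝ) < m := by linarith
    exact_mod_cast this
  obtain ⟨h1, h2⟩ := le_of_sampleBound_le (by norm_num) hxmin hxmax h
  have hn : 0 < n := by
    rcases Nat.eq_zero_or_pos n with rfl | hn
    · exfalso
      have hk' : (0 : ℝ) < k := by exact_mod_cast hk
      have hm' : (0 : ℝ) < m := by exact_mod_cast (by omega : 0 < m)
      have hL0 : 0 < Real.log (d / δ) := by linarith
      have : 0 < 10 ^ 8 * Real.log (d / δ) * (k * xmax ^ 2 / m + (σ : ℝ) ^ 2) ^ 2 := by positivity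
      simp only [Nat.cast_zero, zero_mul] at h2
      linarith
    · exact hn
  have hexp : d * Real.exp (-Real.log (d / δ)) ≤ δ := by
    rw [Real.exp_neg, Real.exp_log (by positivity), inv_div, mul_div_cancel₀ _ hd0.ne']
  have hmis := fun (S : Finset (Fin d)) (hS : S.card = k) (x : Fin n → Fin d → ℝ)
    (hadm : AdmissibleInputs S xmin xmax x) =>
    measure_misplaced_le hn hm hk hxmin hx hL hmL rfl h1 h2 hS hadm
  refine ⟨fun S hS x hadm => ?_, fun S hS x hadm => ⟨separatingThreshold m σ xmin x, ?_⟩⟩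
  · exact errorProb_le_of_misplaced hexp (Real.exp_pos _).le (hmis S hS x hadm)
      fun Y Φ hYΦ => largest_eq_of_separated hkd hS hYΦ
  · refine errorProb_le_of_misplaced hexp (Real.exp_pos _).le (hmis S hS x hadm)
      fun Y Φ hYΦ => ?_
    ext u
    simp [thresholdSet, hYΦ]

/-- If `d = k` then the support is everything, and no samples are needed. -/
lemma recovers_of_eq {n m k d : ℕ} {xmin xmax : ℝ} {σ : ℝ≥0} {δ : ℝ} (hkd : k = d)
    (hδ : 0 < δ) :
    Recovers (closedFormEstimator n m hkd.le) xmin xmax σ δ ∧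
      ∀ S : Finset (Fin d), S.card = k → ∀ x : Fin n → Fin d → ℝ, AdmissibleInputs S xmin xmax x →
        ∃ τ : ℝ, errorProb (m := m) σ (thresholdSet τ) S x ≤ δ := by
  have huniv : ∀ S : Finset (Fin d), S.card = k → S = Finset.univ := fun S hS =>
    (Finset.card_eq_iff_eq_univ S).1 (by rw [hS, hkd, Fintype.card_fin])
  refine ⟨fun S hS x _ => ?_, fun S hS x _ => ⟨0, ?_⟩⟩
  · have : ∀ Y Φ, (closedFormEstimator n m hkd.le).toFun Y Φ = S := fun Y Φ => by
      rw [huniv S hS, huniv _ ((closedFormEstimator n m hkd.le).card_eq Y Φ)]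
    simp [errorProb, this, hδ.le]
  · have : ∀ (Y : Fin n × Fin m → ℝ) (Φ : Fin n × Fin m × Fin d → ℝ),
        thresholdSet 0 Y Φ = S := fun Y Φ => by
      rw [huniv S hS]
      ext u
      simp only [thresholdSet, Finset.mem_filter, Finset.mem_univ, true_and, iff_true]
      unfold secondMoment
      positivity
    simp [errorProb, this, hδ.le]

lemma sampleBound_nonneg {m k d : ℕ} {xmin xmax : ℝ} {σ : ℝ≥0} {δ : ℝ}
    (hlog : 0 ≤ Real.log (d / δ)) : 0 ≤ sampleBound m k d xmin xmax σ δ := by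
  unfold sampleBound
  refine mul_nonneg (by positivity) (le_max_of_le_right (by positivity))

lemma log_le_sampleBound {m k d : ℕ} {xmin xmax : ℝ} {σ : ℝ≥0} {δ : ℝ} (hm : 0 < m)
    (hmk : m ≤ k) (hxmin : 0 < xmin) (hx : xmin ≤ xmax) (hlog : 0 ≤ Real.log (d / δ)) :
    Real.log (d / δ) ≤ sampleBound m k d xmin xmax σ δ := by
  have hm' : (0 : ℝ) < m := by exact_mod_cast hm
  have hmk' : (m : ℝ) ≤ k := by exact_mod_cast hmk
  have h1 : 1 ≤ xmax ^ 4 / xmin ^ 4 := by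
    rw [one_le_div (by positivity)]; gcongr
  have h2 : 1 ≤ (k : ℝ) / m + (σ : ℝ) ^ 2 / xmax ^ 2 := by
    have : 1 ≤ (k : ℝ) / m := by rwa [one_le_div hm']
    have : 0 ≤ (σ : ℝ) ^ 2 / xmax ^ 2 := by positivity
    linarith
  unfold sampleBound
  calc Real.log (d / δ) = 1 * (1 * Real.log (d / δ)) := by ring
    _ ≤ _ := by
      refine mul_le_mul h1 (le_max_of_le_left ?_) (by linarith) (by positivity)
      gcongr

end SupportRecovery

theorem theorem1 :
    ∃ C : ℝ, 0 < C ∧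
      ∀ (m k d : ℕ) (xmin xmax : ℝ) (σ : ℝ≥0) (δ : ℝ),
        0 < m → 0 < k → ∀ hkd : k ≤ d,
        0 < xmin → xmin ≤ xmax → 0 < δ → δ < 1 →
        2 * Real.log (d / δ) ≤ m →
        -- the sample complexity is attained, and it obeys the bound
        IsLeast (SupportRecovery.feasibleSampleSizes m k d xmin xmax σ δ)
            (SupportRecovery.sampleComplexity m k d xmin xmax σ δ) ∧
        (SupportRecovery.sampleComplexity m k d xmin xmax σ δ : ℝ) ≤
            max 1 (C * SupportRecovery.sampleBound m k d xmin xmax σ δ) ∧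
        (m ≤ k → (SupportRecovery.sampleComplexity m k d xmin xmax σ δ : ℝ) ≤
            C * SupportRecovery.sampleBound m k d xmin xmax σ δ) ∧
        -- the bound is achieved by the closed-form estimator, and by thresholding
        ∀ n : ℕ, C * SupportRecovery.sampleBound m k d xmin xmax σ δ ≤ n →
          SupportRecovery.Recovers (SupportRecovery.closedFormEstimator n m hkd) xmin xmax σ δ ∧
          ∀ S : Finset (Fin d), S.card = k → ∀ x : Fin n → Fin d → ℝ,
            SupportRecovery.AdmissibleInputs S xmin xmax x →
            ∃ τ : ℝ, SupportRecovery.errorProb (m := m) σ (SupportRecovery.thresholdSet τ) S x ≤ δ := by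
  open SupportRecovery in
  -- twice the constant that suffices for recovery, to absorb rounding up to an integer
  refine ⟨2 * 10 ^ 8, by norm_num, ?_⟩
  intro m k d xmin xmax σ δ hm hk hkd hxmin hx hδ hδ1 hmL
  have hd1 : (1 : ℝ) ≤ d := by exact_mod_cast hk.trans_le hkd
  have hlog : 0 ≤ Real.log (d / δ) := Real.log_nonneg (by rw [le_div_iff₀ hδ]; linarith)
  have hB0 : 0 ≤ sampleBound m k d xmin xmax σ δ := sampleBound_nonneg hlog
  have hleast : ∀ n, n ∈ feasibleSampleSizes m k d xmin xmax σ δ →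
      IsLeast (feasibleSampleSizes m k d xmin xmax σ δ) (sampleComplexity m k d xmin xmax σ δ) ∧
        sampleComplexity m k d xmin xmax σ δ ≤ n := fun n hn =>
    ⟨⟨Nat.sInf_mem ⟨n, hn⟩, fun _ h => Nat.sInf_le h⟩, Nat.sInf_le hn⟩
  rcases Nat.lt_or_ge d 2 with hd | hd
  · -- for `d = 1` the logarithm may be arbitrarily small, but the support is known
    have hkd' : k = d := by omega
    obtain ⟨h1, h2⟩ := hleast 0 ⟨closedFormEstimator 0 m hkd, (recovers_of_eq hkd' hδ).1⟩
    rw [Nat.le_zero.1 h2] at h1 ⊢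
    refine ⟨h1, ?_, fun _ => ?_, fun n _ => recovers_of_eq hkd' hδ⟩
    · rw [Nat.cast_zero]; exact le_max_of_le_left zero_le_one
    · rw [Nat.cast_zero]; positivity
  · obtain ⟨h1, h2⟩ := hleast ⌈10 ^ 8 * sampleBound m k d xmin xmax σ δ⌉₊
      ⟨closedFormEstimator _ m hkd,
        (recovers_of_sampleBound_le hk hkd hd hxmin hx hδ hδ1 hmL (Nat.le_ceil _)).1⟩
    have h2' : (sampleComplexity m k d xmin xmax σ δ : ℝ) ≤
        (⌈10 ^ 8 * sampleBound m k d xmin xmax σ δ⌉₊ : ℝ) := by exact_mod_cast h2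
    have hceil := Nat.ceil_lt_add_one
      (by positivity : 0 ≤ 10 ^ 8 * sampleBound m k d xmin xmax σ δ)
    refine ⟨h1, ?_, fun hmk => ?_, fun n hn =>
      recovers_of_sampleBound_le hk hkd hd hxmin hx hδ hδ1 hmL (by linarith)⟩
    · rcases le_total (10 ^ 8 * sampleBound m k d xmin xmax σ δ) 1 with hle | hle
      · apply le_max_of_le_left
        have : ⌈10 ^ 8 * sampleBound m k d xmin xmax σ δ⌉₊ ≤ 1 := Nat.ceil_le.2 (by simpa using hle)
        exact h2'.trans (by exact_mod_cast this)
      · apply le_max_of_le_right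
        linarith
    · have hlogB := log_le_sampleBound (σ := σ) hm hmk hxmin hx hlog
      have hd' : (2 : ℝ) ≤ d := by exact_mod_cast hd
      have hlog2 : Real.log 2 ≤ Real.log (d / δ) :=
        Real.log_le_log (by norm_num) (by rw [le_div_iff₀ hδ]; linarith)
      have := Real.log_two_gt_d9
      linarith
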